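/- **Setting.** Let $Z,N\sim\mathcal N(0,1)$ be independent. Call $f:\mathbb R\to\mathbb R$ *admissible* if $\mathbb R$ is a finite disjoint union of intervals (possibly single points) on each of which $f$ is continuously differentiable and either strictly monotonic or constant, and $\lfloor f(Z)\rfloor$ has finite entropy. For $v\in(0,1]$ put $$\mathsf{mmse}_z(v)=\mathbb E\Big[\big(Z-\mathbb E[Z\mid \sqrt{v^{-1}-1}\,Z+N,\ f(Z)]\big)^2\Big],\qquad \phi(v)=\Big(\frac1{\mathsf{mmse}_z(v)}-\frac1v\Big)^{-1}\in[0,\infty],$$ $$g(v)=1-\delta\Big(1-\frac{\mathsf{mmse}_z(v)}{v}\Big),\qquad G(v)=\max(g(v),0),$$ with $\phi(0)=\lim_{v\downarrow0}\phi(v)$ and $g(0)=\lim_{v\downarrow0}g(v)$. For $\delta>1$, a *spectrum at ratio $\delta$* is (the law of) a random variable $\lambda$ with values in some compact interval $[a,b]$, $a>0$, and $\mathbb E[\lambda]=\delta$. For such $\lambda$ and $v\in[0,\infty]$ let $$\Phi(v)=\Big(\frac{1}{\frac1\delta\,\mathbb E\big[\frac{v\lambda}{v+\lambda}\big]}-\frac1v\Big)^{-1},\qquad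 \mathsf{MSE}_\lambda(v)=\mathbb E\Big[\frac{v}{v+\lambda}\Big],$$ with the limiting values $\Phi(0)=0$, $\Phi(\infty)=1$, $\mathsf{MSE}_\lambda(0)=0$, $\mathsf{MSE}_\lambda(\infty)=1$. The state evolution of GLM-EP is $V_r^{-1}=1$, $V_l^{t}=\phi(V_r^{t-1})$, $V_r^{t}=\Phi(V_l^{t})$ for $t\ge0$; put $V_\lambda^\star=\lim_{t\to\infty}V_r^t$ and $\mathsf{MSE}^\star_\lambda=\mathsf{MSE}_\lambda(\phi(V^\star_\lambda))$. For a nonnegative random variable with distribution function $F$ let $F^{-1}(y)=\sup\{x:F(x)\le y\}$ and $L(u)=\int_0^uF^{-1}(y)\,dy\big/\int_0^1F^{-1}(y)\,dy$; $\lambda_1$ is *spikier* than $\lambda_2$, written $\lambda_1\succeq_L\lambda_2$, if $L_{\lambda_1}(u)\le L_{\lambda_2}(u)$ for all $u\in[0,1]$. **Statement.** Let $\delta>1$. For every admissible $f$ and all spectra $\lambda_1\succeq_L\lambda_2$ at ratio $\delta$, the limits $V^\star_{\lambda_1}$ and $V^\star_{\lambda_2}$ exist, and 1. if $G$ is (weakly)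 increasing on $[0,1]$, then $\mathsf{MSE}^\star_{\lambda_1}\le\mathsf{MSE}^\star_{\lambda_2}$; 2. if $G$ is (weakly) decreasing on $[0,1]$, then $\mathsf{MSE}^\star_{\lambda_1}\ge\mathsf{MSE}^\star_{\lambda_2}$. 3. If $G$ is not monotonic, the comparison is in general not definite: there is an admissible $f$ for which $G$ is neither increasing nor decreasing on $[0,1]$ and for which there are spectra $\lambda_1\succeq_L\lambda_2$ at ratio $\delta$ with $\mathsf{MSE}^\star_{\lambda_1}<\mathsf{MSE}^\star_{\lambda_2}$, and also spectra $\lambda_1'\succeq_L\lambda_2'$ at ratio $\delta$ with $\mathsf{MSE}^\star_{\lambda_1'}>\mathsf{MSE}^\star_{\lambda_2'}$. -/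

import Mathlib

open MeasureTheory ProbabilityTheory Filter Topology Set
open scoped ENNReal

namespace GLMEP

noncomputable section

/-- The conditional MMSE `mmse(Z, snr | U) = E[(Z - E[Z | √snr Z + N, U])²]`, where the noise
`N ∼ N(0,1)` is independent of `(Z, U)`. It is realised on the product of the space `Ω` on which
`(Z, U)` lives with the line carrying the law of `N`, so `ω.2` is `N`. -/
def condMMSE {Ω S : Type*} [MeasurableSpace Ω] [MeasurableSpace S] (μ : Measure Ω)
    (Z : Ω → ℝ) (U : Ω → S) (snr : ℝ) : ℝ :=
  ∫ ω, (Z ω.1 - ((μ.prod (gaussianReal 0 1))[fun ω : Ω × ℝ => Z ω.1 |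
      MeasurableSpace.comap (fun ω : Ω × ℝ => (√snr * Z ω.1 + ω.2, U ω.1)) inferInstance]) ω) ^ 2
    ∂(μ.prod (gaussianReal 0 1))

/-- `mmse_z(v) = mmse(Z, 1/v - 1 | f(Z))` with `Z ∼ N(0,1)`, for `v ∈ (0,1]`. -/
def mmseZ (f : ℝ → ℝ) (v : ℝ) : ℝ :=
  condMMSE (gaussianReal 0 1) (fun z => z) f (v⁻¹ - 1)

/-- The state evolution map `φ(v) = (1 / mmse_z(v) - 1 / v)⁻¹`, with values in `[0,∞]`:
it is `∞` where `mmse_z(v) = v` and `0` where `mmse_z(v) = 0`. At `v = 0` it is the limit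
from the right. -/
def phi (f : ℝ → ℝ) (v : ℝ) : ℝ≥0∞ :=
  if v = 0 then
    limUnder (𝓝[>] (0 : ℝ))
      (fun w : ℝ => ((ENNReal.ofReal (mmseZ f w))⁻¹ - (ENNReal.ofReal w)⁻¹)⁻¹)
  else ((ENNReal.ofReal (mmseZ f v))⁻¹ - (ENNReal.ofReal v)⁻¹)⁻¹

/-- `E[v λ / (v + λ)]` for `λ ∼ P`, `v ∈ [0,∞]`. The integrand is written as `(1/v + 1/λ)⁻¹`,
which is the same for `0 < v < ∞` and takes the limiting values `0` at `v = 0` and `λ` at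
`v = ∞`. -/
def meanHarm (P : Measure ℝ) (v : ℝ≥0∞) : ℝ≥0∞ :=
  ∫⁻ x, (v⁻¹ + (ENNReal.ofReal x)⁻¹)⁻¹ ∂P

/-- The state evolution map `Φ(v) = (1 / ((1/δ) E[v λ / (v + λ)]) - 1 / v)⁻¹`, `v ∈ [0,∞]`,
with `Φ(0) = 0`. -/
def Phi (δ : ℝ) (P : Measure ℝ) (v : ℝ≥0∞) : ℝ :=
  if v = 0 then 0
  else (((ENNReal.ofReal δ)⁻¹ * meanHarm P v)⁻¹ - v⁻¹)⁻¹.toReal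

/-- The state evolution sequence `V_r`, with the index shifted by one: `seVr 0` is the
initialisation `V_r^{-1} = 1`, and `seVr (t + 1) = V_r^t = Φ(V_l^t)` with
`V_l^t = φ(V_r^{t-1})`. -/
def seVr (f : ℝ → ℝ) (δ : ℝ) (P : Measure ℝ) : ℕ → ℝ
  | 0 => 1
  | t + 1 => Phi δ P (phi f (seVr f δ P t))

/-- The limit `V_λ^⋆` of the state evolution sequence `V_r^t` as `t → ∞`. -/
def Vstar (f : ℝ → ℝ) (δ : ℝ) (P : Measure ℝ) : ℝ :=
  limUnder atTop (seVr f δ P)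

/-- `MSE_λ(v) = E[v / (v + λ)]` for `λ ∼ P`, `v ∈ [0,∞]`. The integrand is written as
`(1 + λ/v)⁻¹`, which for `λ > 0` is `0` at `v = 0` and `1` at `v = ∞`. -/
def mse (P : Measure ℝ) (v : ℝ≥0∞) : ℝ :=
  (∫⁻ x, (1 + ENNReal.ofReal x / v)⁻¹ ∂P).toReal

/-- The final mean square error `MSE_λ^⋆ = MSE_λ(φ(V_λ^⋆))`. -/
def mseStar (f : ℝ → ℝ) (δ : ℝ) (P : Measure ℝ) : ℝ :=
  mse P (phi f (Vstar f δ P))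

/-- `g(v) = 1 - δ (1 - mmse_z(v) / v)`; at `v = 0` it is the limit from the right. -/
def gFun (f : ℝ → ℝ) (δ v : ℝ) : ℝ :=
  if v = 0 then limUnder (𝓝[>] (0 : ℝ)) (fun w : ℝ => 1 - δ * (1 - mmseZ f w / w))
  else 1 - δ * (1 - mmseZ f v / v)

/-- `G(v) = max(g(v), 0)`. -/
def GFun (f : ℝ → ℝ) (δ v : ℝ) : ℝ := max (gFun f δ v) 0

/-- The quantile function `F⁻¹(y) = sup {x : F(x) ≤ y}` of the distribution `P` with
cumulative distribution function `F`. -/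
def quantile (P : Measure ℝ) (y : ℝ) : ℝ := sSup {x : ℝ | cdf P x ≤ y}

/-- The Lorenz curve `L(u) = ∫_0^u F⁻¹ / ∫_0^1 F⁻¹` of the distribution `P`. -/
def lorenzCurve (P : Measure ℝ) (u : ℝ) : ℝ :=
  (∫ y in (0 : ℝ)..u, quantile P y) / (∫ y in (0 : ℝ)..1, quantile P y)

/-- `P₁` is spikier than `P₂` in the Lorenz order. -/
def Spikier (P₁ P₂ : Measure ℝ) : Prop :=
  ∀ u ∈ Icc (0 : ℝ) 1, lorenzCurve P₁ u ≤ lorenzCurve P₂ u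

/-- The admissible limiting eigenvalue distributions at sampling ratio `δ`: probability
measures supported in a compact interval `[a,b]` with `a > 0` and having mean `δ`. -/
structure IsLimitingSpectrum (δ : ℝ) (P : Measure ℝ) : Prop where
  prob : IsProbabilityMeasure P
  support : ∃ a b : ℝ, 0 < a ∧ P (Icc a b)ᶜ = 0
  mean : ∫ x, x ∂P = δ

/-- The admissible nonlinearities: the line is the union of finitely many disjoint intervals
(possibly degenerate) on each of which `f` is continuously differentiable and either strictly
monotonic or constant; and the entropy of `⌊f(Z)⌋`, `Z ∼ N(0,1)`, is finite. -/
structure IsAdmissible (f : ℝ → ℝ) : Prop where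
  pieces : ∃ (K : ℕ) (I : Fin K → Set ℝ),
    (∀ k, (I k).OrdConnected) ∧ Pairwise (fun i j => Disjoint (I i) (I j)) ∧
    (⋃ k, I k) = univ ∧
    ∀ k, ContDiffOn ℝ 1 f (I k) ∧
      (StrictMonoOn f (I k) ∨ StrictAntiOn f (I k) ∨ ∃ c, ∀ x ∈ I k, f x = c)
  entropy : Summable fun k : ℤ =>
    Real.negMulLog ((gaussianReal 0 1).real {z : ℝ | ⌊f z⌋ = k})

end

end GLMEP

namespace GLMEP

noncomputable section

/-! Write `ψ(v) = 1/φ(v)` and `H(x) = E[λ/(1+xλ)]`. Then `Φ = (δ/H(ψ) - ψ)⁻¹` and `MSE = 1 - ψ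
H(ψ)`. A positive point `v` is fixed by the state evolution exactly when `H(ψ(v)) = δ mmse_z(v)`,
and substituting this gives `MSE = g(v)`: at a fixed point the error depends on the spectrum only
through the location of that point (`mse_eq_gFun`). Since `l/(1+xl)` is concave in `l`, a spikier
spectrum has a smaller `H` (`Spikier.harm_le`), hence a smaller `Φ` and a smaller limit
(`Vstar_le_Vstar`). Monotonicity of `G` then decides the comparison.

Two analytic facts make this work. Combining an optimal estimate with a further independent Gaussian
observation shows that `1/mmse` grows at least linearly in the signal-to-noise ratio
(`gmmse_add_le`), so `φ` is increasing and the iteration decreases. The MMSE is moreover upper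
semicontinuous, being an infimum of errors of bounded continuous estimators (`eventually_gmmse_lt`);
with monotonicity this is enough continuity to make a positive limit a fixed point (`step_Vstar`). A
zero limit is treated apart: the error is then `0`, and `G` becomes arbitrarily small near `0`
(`eventually_GFun_lt`).

For the indefinite case `f` is the indicator of a very short interval, and a constant spectrum is
compared with two-point spectra. Near `v = 1` the relative gain `1 - mmse_z(v)/v` is tiny, so the
constant spectrum gets stuck there, while a suitable two-point spectrum gets past
(`exists_mseStar_lt_dirac`). As `v → 0` the gain vanishes again, so another two-point spectrum gets
stuck at or above a small `v` with an error larger than that of the constant one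
(`exists_mseStar_dirac_lt`). By the monotone cases, these two strict inequalities also show that `G`
is not monotonic. -/

/-! ### Estimation of a Gaussian variable and properties of the MMSE. -/

/-- The square integral, as an extended nonnegative number. -/
def sqInt {Ω : Type*} [MeasurableSpace Ω] (μ : Measure Ω) (X : Ω → ℝ) : ℝ≥0∞ :=
  ∫⁻ ω, ENNReal.ofReal (X ω ^ 2) ∂μ

/-- The standard Gaussian measure on the plane. -/
abbrev gauss2 : Measure (ℝ × ℝ) := (gaussianReal 0 1).prod (gaussianReal 0 1)

lemma sqInt_eq_ofReal {Ω : Type*} [MeasurableSpace Ω] {μ : Measure Ω} {X : Ω → ℝ}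
    (hX : MemLp X 2 μ) : sqInt μ X = ENNReal.ofReal (∫ ω, X ω ^ 2 ∂μ) :=
  (ofReal_integral_eq_lintegral_ofReal hX.integrable_sq (ae_of_all _ fun _ => sq_nonneg _)).symm

lemma memLp_of_sqInt_ne_top {Ω : Type*} [MeasurableSpace Ω] {μ : Measure Ω} {X : Ω → ℝ}
    (hm : AEStronglyMeasurable X μ) (h : sqInt μ X ≠ ∞) : MemLp X 2 μ := by
  rw [memLp_two_iff_integrable_sq hm]
  refine ⟨hm.pow 2, ?_⟩
  rw [hasFiniteIntegral_iff_ofReal (ae_of_all _ fun _ => sq_nonneg _)]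
  exact lt_top_iff_ne_top.2 h

/-- Subtracting the `m`-measurable `Y` leaves the conditional variance unchanged, and a conditional
variance is at most the conditional second moment. -/
lemma integral_sq_sub_condExp_le {Ω : Type*} {m m₀ : MeasurableSpace Ω} {μ : Measure Ω}
    [IsProbabilityMeasure μ] (hm : m ≤ m₀) {X Y : Ω → ℝ} (hX : MemLp X 2 μ) (hY : MemLp Y 2 μ)
    (hYm : StronglyMeasurable[m] Y) :
    ∫ ω, (X ω - (μ[X | m]) ω) ^ 2 ∂μ ≤ ∫ ω, (X ω - Y ω) ^ 2 ∂μ := by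
  have hXY : MemLp (X - Y) 2 μ := hX.sub hY
  have h1 : μ[X - Y | m] =ᵐ[μ] μ[X | m] - Y := by
    refine (condExp_sub (hX.integrable one_le_two) (hY.integrable one_le_two) m).trans ?_
    rw [condExp_of_stronglyMeasurable hm hYm (hY.integrable one_le_two)]
  have h2 : ∫ ω, (X ω - (μ[X | m]) ω) ^ 2 ∂μ = ∫ ω, (Var[X - Y; μ | m]) ω ∂μ := by
    rw [condVar, integral_condExp hm]
    refine integral_congr_ae ?_
    filter_upwards [h1] with ω h
    simp only [Pi.pow_apply, Pi.sub_apply] at h ⊢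
    rw [h]; ring
  rw [h2, ← integral_condExp hm (f := fun ω => (X ω - Y ω) ^ 2)]
  refine integral_mono_ae integrable_condVar integrable_condExp ?_
  exact condVar_ae_le_condExp_sq hm hXY

lemma memLp_fst_gauss2 : MemLp (fun ω : ℝ × ℝ => ω.1) 2 gauss2 :=
  (memLp_id_gaussianReal' 2 (by simp)).comp_measurePreserving measurePreserving_fst

lemma memLp_snd_gauss2 : MemLp (fun ω : ℝ × ℝ => ω.2) 2 gauss2 :=
  (memLp_id_gaussianReal' 2 (by simp)).comp_measurePreserving measurePreserving_snd

/-- The error of the estimator `h` of `Z` from `√s Z + N` and `f(Z)`. -/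
def estErr (f : ℝ → ℝ) (s : ℝ) (h : ℝ × ℝ → ℝ) : ℝ≥0∞ :=
  sqInt gauss2 (fun ω => ω.1 - h (√s * ω.1 + ω.2, f ω.1))

/-- The minimal error in estimating `Z` from `√s Z + N` and `f(Z)`. -/
abbrev gmmse (f : ℝ → ℝ) (s : ℝ) : ℝ := condMMSE (gaussianReal 0 1) (fun z => z) f s

lemma measurable_obs {f : ℝ → ℝ} (hf : Measurable f) (s : ℝ) :
    Measurable (fun ω : ℝ × ℝ => (√s * ω.1 + ω.2, f ω.1)) :=
  Measurable.prodMk (by fun_prop) (hf.comp measurable_fst)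

lemma gmmse_nonneg (f : ℝ → ℝ) (s : ℝ) : 0 ≤ gmmse f s :=
  integral_nonneg fun _ => sq_nonneg _

lemma gmmse_le_estErr {f : ℝ → ℝ} (hf : Measurable f) (s : ℝ) {h : ℝ × ℝ → ℝ}
    (hh : Measurable h) : ENNReal.ofReal (gmmse f s) ≤ estErr f s h := by
  by_cases hfin : estErr f s h = ∞
  · rw [hfin]; exact le_top
  have hO := measurable_obs hf s
  have hD := memLp_of_sqInt_ne_top (by fun_prop) hfin
  have hY : MemLp (fun ω : ℝ × ℝ => h (√s * ω.1 + ω.2, f ω.1)) 2 gauss2 := by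
    have := memLp_fst_gauss2.sub hD
    simpa [Pi.sub_def] using this
  rw [estErr, sqInt_eq_ofReal hD]
  refine ENNReal.ofReal_le_ofReal ?_
  refine integral_sq_sub_condExp_le hO.comap_le memLp_fst_gauss2 hY ?_
  exact (hh.comp (comap_measurable _)).stronglyMeasurable

/-- The conditional expectation is measurable for the σ-algebra of the observation, hence a Borel
function of it. Together with `gmmse_le_estErr` this turns the MMSE into a minimum over Borel
estimators, the only form used later. -/
lemma exists_estErr_eq_gmmse (f : ℝ → ℝ) (s : ℝ) :
    ∃ h : ℝ × ℝ → ℝ, Measurable h ∧ estErr f s h = ENNReal.ofReal (gmmse f s) ∧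
      MemLp (fun ω : ℝ × ℝ => h (√s * ω.1 + ω.2, f ω.1)) 2 gauss2 := by
  obtain ⟨h, hh, he⟩ := (stronglyMeasurable_condExp (μ := gauss2)
    (m := MeasurableSpace.comap (fun ω : ℝ × ℝ => (√s * ω.1 + ω.2, f ω.1)) inferInstance)
    (f := fun ω : ℝ × ℝ => ω.1)).exists_eq_measurable_comp
  have hL : MemLp (fun ω : ℝ × ℝ => h (√s * ω.1 + ω.2, f ω.1)) 2 gauss2 := by
    have := memLp_fst_gauss2.condExp one_le_two
      (m := MeasurableSpace.comap (fun ω : ℝ × ℝ => (√s * ω.1 + ω.2, f ω.1)) inferInstance)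
    rwa [he] at this
  refine ⟨h, hh.measurable, ?_, hL⟩
  have hD : MemLp (fun ω : ℝ × ℝ => ω.1 - h (√s * ω.1 + ω.2, f ω.1)) 2 gauss2 :=
    memLp_fst_gauss2.sub hL
  rw [estErr, sqInt_eq_ofReal hD]
  congr 1
  unfold gmmse condMMSE
  rw [he]
  rfl

lemma map_rotation_gauss2 {a b : ℝ} (hab : a ^ 2 + b ^ 2 = 1) :
    gauss2.map (fun ω : ℝ × ℝ => (a * ω.1 + b * ω.2, -b * ω.1 + a * ω.2)) = gauss2 := by
  obtain ⟨θ, hc, hs⟩ : ∃ θ : ℝ, Real.cos θ = a ∧ Real.sin θ = b := by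
    refine ⟨Complex.arg ⟨a, b⟩, ?_, ?_⟩
    · rw [Complex.cos_arg]
      · simp [Complex.norm_def, Complex.normSq_apply, ← sq, hab]
      · intro h
        have h1 := congrArg Complex.re h
        have h2 := congrArg Complex.im h
        simp at h1 h2
        simp [h1, h2] at hab
    · rw [Complex.sin_arg]
      simp [Complex.norm_def, Complex.normSq_apply, ← sq, hab]
  have := IsGaussian.map_rotation_eq_self (μ := gaussianReal 0 1)
    (by simp) θ
  rw [← hc, ← hs]
  exact this

lemma integral_sq_gaussian : ∫ x, x ^ 2 ∂(gaussianReal 0 1) = 1 := by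
  have := variance_id_gaussianReal (μ := 0) (v := 1)
  rw [variance_eq_integral (by fun_prop)] at this
  simpa using this

lemma integral_affine_sq_gaussian (a b : ℝ) :
    ∫ x, (a + b * x) ^ 2 ∂(gaussianReal 0 1) = a ^ 2 + b ^ 2 := by
  have h2 : Integrable (fun x : ℝ => x ^ 2) (gaussianReal 0 1) :=
    (memLp_id_gaussianReal' 2 (by simp)).integrable_sq
  have h1 : Integrable (fun x : ℝ => x) (gaussianReal 0 1) :=
    (memLp_id_gaussianReal' 2 (by simp)).integrable one_le_two
  have : ∀ x : ℝ, (a + b * x) ^ 2 = a ^ 2 + ((2 * a * b) * x + b ^ 2 * x ^ 2) := fun x => by ring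
  have h3 : Integrable (fun x : ℝ => (2 * a * b) * x) (gaussianReal 0 1) := h1.const_mul _
  have h4 : Integrable (fun x : ℝ => b ^ 2 * x ^ 2) (gaussianReal 0 1) := h2.const_mul _
  have h5 : Integrable (fun x : ℝ => (2 * a * b) * x + b ^ 2 * x ^ 2) (gaussianReal 0 1) :=
    h3.add h4
  simp_rw [this]
  rw [integral_add (integrable_const _) h5, integral_add h3 h4,
    integral_const_mul, integral_const_mul, integral_sq_gaussian]
  simp [integral_id_gaussianReal]

lemma lintegral_affine_sq_gaussian (a b : ℝ) :
    ∫⁻ x, ENNReal.ofReal ((a + b * x) ^ 2) ∂(gaussianReal 0 1) = ENNReal.ofReal (a ^ 2 + b ^ 2) := by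
  have hm : MemLp (fun x : ℝ => a + b * x) 2 (gaussianReal 0 1) :=
    (memLp_const a).add ((memLp_id_gaussianReal' 2 (by simp)).const_mul b)
  rw [← integral_affine_sq_gaussian]
  exact sqInt_eq_ofReal hm

lemma map_neg_snd_gauss2 : gauss2.map (fun ω : ℝ × ℝ => (ω.1, -ω.2)) = gauss2 := by
  have h : (gaussianReal 0 1).map (fun x : ℝ => -x) = gaussianReal 0 1 := by
    have := gaussianReal_map_neg (μ := 0) (v := 1)
    simpa using this
  have := Measure.map_prod_map (gaussianReal 0 1) (gaussianReal 0 1) (f := fun x : ℝ => x)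
    (g := fun x : ℝ => -x) (by fun_prop) (by fun_prop)
  rw [h] at this
  simp only [Measure.map_id'] at this
  exact this.symm

/-- A rotation followed by a sign change. Unlike the rotation, this matrix is its own inverse, which
is convenient for changing variables back. -/
lemma map_reflection_gauss2 {a b : ℝ} (hab : a ^ 2 + b ^ 2 = 1) :
    gauss2.map (fun ω : ℝ × ℝ => (a * ω.1 + b * ω.2, b * ω.1 - a * ω.2)) = gauss2 := by
  conv_rhs => rw [← map_neg_snd_gauss2, ← map_rotation_gauss2 hab,
    Measure.map_map (by fun_prop) (by fun_prop)]
  congr 1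
  funext ω
  simp only [Function.comp, Prod.mk.injEq, true_and]
  ring

lemma measurePreserving_reflection_gauss2 {a b : ℝ} (hab : a ^ 2 + b ^ 2 = 1) :
    MeasurePreserving (fun ω : ℝ × ℝ => (a * ω.1 + b * ω.2, b * ω.1 - a * ω.2)) gauss2 gauss2 :=
  ⟨by fun_prop, map_reflection_gauss2 hab⟩

/-- The error of the estimator `h` of `W` from `M` and `f(√(1-v) M + √v W)`, for independent
standard Gaussian variables `M`, `W`. -/
def residErr (f : ℝ → ℝ) (v : ℝ) (h : ℝ × ℝ → ℝ) : ℝ≥0∞ :=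
  sqInt gauss2 (fun ω => ω.2 - h (ω.1, f (√(1 - v) * ω.1 + √v * ω.2)))

lemma sqInt_const_mul {Ω : Type*} [MeasurableSpace Ω] (μ : Measure Ω) (c : ℝ) {X : Ω → ℝ}
    (hX : Measurable X) : sqInt μ (fun ω => c * X ω) = ENNReal.ofReal (c ^ 2) * sqInt μ X := by
  unfold sqInt
  rw [← lintegral_const_mul _ (by fun_prop)]
  refine lintegral_congr fun ω => ?_
  rw [← ENNReal.ofReal_mul (sq_nonneg c), mul_pow]

/-- The variables `M = √(1-v) Z + √v N` and `W = √v Z - √(1-v) N` are independent standard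
Gaussians, `M` is `√v` times the observation, and `Z = √(1-v) M + √v W`. Once `M` is known, only `√v
W` remains to be estimated. -/
lemma estErr_eq_residErr {f : ℝ → ℝ} (hf : Measurable f) {v : ℝ} (hv : 0 < v) (hv1 : v ≤ 1)
    {h : ℝ × ℝ → ℝ} (hh : Measurable h) :
    estErr f (v⁻¹ - 1) (fun p => √(1 - v) * (√v * p.1) + √v * h (√v * p.1, p.2)) =
      ENNReal.ofReal v * residErr f v h := by
  have hv' : 0 < √v := Real.sqrt_pos.2 hv
  have ha : √v ^ 2 = v := Real.sq_sqrt hv.le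
  have hb : √(1 - v) ^ 2 = 1 - v := Real.sq_sqrt (by linarith)
  have hs : √(v⁻¹ - 1) * √v = √(1 - v) := by
    rw [← Real.sqrt_mul' _ hv.le]; congr 1; field_simp
  set a := √v
  set b := √(1 - v)
  have key := (measurePreserving_reflection_gauss2 (a := b) (b := a)
    (by rw [ha, hb]; ring)).lintegral_comp
    (f := fun x : ℝ × ℝ => ENNReal.ofReal ((a * (x.2 - h (x.1, f (b * x.1 + a * x.2)))) ^ 2))
    (by fun_prop)
  have h1 : ENNReal.ofReal v * residErr f v h =
      sqInt gauss2 (fun x : ℝ × ℝ => a * (x.2 - h (x.1, f (b * x.1 + a * x.2)))) := by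
    rw [sqInt_const_mul _ _ (by fun_prop), ha]; rfl
  rw [h1]
  unfold sqInt
  rw [← key]
  refine lintegral_congr fun ω => ?_
  have e1 : a * (√(v⁻¹ - 1) * ω.1 + ω.2) = b * ω.1 + a * ω.2 := by rw [← hs]; ring
  have e2 : b * (b * ω.1 + a * ω.2) + a * (a * ω.1 - b * ω.2) = ω.1 := by
    linear_combination ω.1 * ha + ω.1 * hb
  simp only [e1, e2]
  congr 2
  linear_combination (-e2)

lemma mmseZ_nonneg (f : ℝ → ℝ) (v : ℝ) : 0 ≤ mmseZ f v := gmmse_nonneg f _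

lemma mmseZ_le_residErr {f : ℝ → ℝ} (hf : Measurable f) {v : ℝ} (hv : 0 < v) (hv1 : v ≤ 1)
    {h : ℝ × ℝ → ℝ} (hh : Measurable h) :
    ENNReal.ofReal (mmseZ f v) ≤ ENNReal.ofReal v * residErr f v h := by
  rw [← estErr_eq_residErr hf hv hv1 hh]
  exact gmmse_le_estErr hf _ (by fun_prop)

lemma exists_residErr_eq {f : ℝ → ℝ} (hf : Measurable f) {v : ℝ} (hv : 0 < v) (hv1 : v ≤ 1) :
    ∃ h : ℝ × ℝ → ℝ, Measurable h ∧
      ENNReal.ofReal (mmseZ f v) = ENNReal.ofReal v * residErr f v h := by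
  obtain ⟨h, hh, he, -⟩ := exists_estErr_eq_gmmse f (v⁻¹ - 1)
  have hv' : √v ≠ 0 := (Real.sqrt_pos.2 hv).ne'
  refine ⟨fun p => (√v)⁻¹ * (h ((√v)⁻¹ * p.1, p.2) - √(1 - v) * p.1), by fun_prop, ?_⟩
  rw [← estErr_eq_residErr hf hv hv1 (by fun_prop)]
  refine Eq.trans he.symm ?_
  congr 1
  funext p
  field_simp
  ring_nf

lemma mmseZ_le_self {f : ℝ → ℝ} (hf : Measurable f) {v : ℝ} (hv : 0 < v) (hv1 : v ≤ 1) :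
    mmseZ f v ≤ v := by
  have h := mmseZ_le_residErr hf hv hv1 (h := fun _ => 0) measurable_const
  have : residErr f v (fun _ => 0) = 1 := by
    unfold residErr
    rw [sqInt_eq_ofReal (by simpa using memLp_snd_gauss2)]
    have := integral_fun_snd (μ := gaussianReal 0 1) (ν := gaussianReal 0 1) (fun x : ℝ => x ^ 2)
    simp only [sub_zero]
    rw [this]
    simp [integral_sq_gaussian]
  rw [this, mul_one] at h
  exact (ENNReal.ofReal_le_ofReal_iff hv.le).1 h

/-- Combining the best estimate at signal-to-noise ratio `s` linearly with an independent
observation at ratio `t`. -/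
lemma gmmse_add_le_combination {f : ℝ → ℝ} (hf : Measurable f) {s t : ℝ} (hs : 0 ≤ s) (ht : 0 < t)
    {α β : ℝ} (hαβ : α + β * √t = 1) :
    gmmse f (s + t) ≤ α ^ 2 * gmmse f s + β ^ 2 := by
  obtain ⟨h, hh, he, -⟩ := exists_estErr_eq_gmmse f s
  have hst : 0 < s + t := by linarith
  -- With an auxiliary independent Gaussian `w`, the observation `Y` at ratio `s + t` splits into
  -- the channels `cY + dw` and `dY - cw`, of ratios `s` and `t` with independent noises.
  set c := √s / √(s + t) with hc
  set d := √t / √(s + t) with hd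
  have hq : 0 < √(s + t) := Real.sqrt_pos.2 hst
  have hc' : c * √(s + t) = √s := by rw [hc]; field_simp
  have hd' : d * √(s + t) = √t := by rw [hd]; field_simp
  have hcd : c ^ 2 + d ^ 2 = 1 := by
    rw [hc, hd, div_pow, div_pow, Real.sq_sqrt hs, Real.sq_sqrt ht.le, Real.sq_sqrt hst.le]
    field_simp
  let est : ℝ → ℝ × ℝ → ℝ := fun w p => α * h (c * p.1 + d * w, p.2) + β * (d * p.1 - c * w)
  have hest : ∀ w, Measurable (est w) := fun w => by fun_prop
  have hle : ∀ w, ENNReal.ofReal (gmmse f (s + t)) ≤ estErr f (s + t) (est w) :=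
    fun w => gmmse_le_estErr hf _ (hest w)
  let G : ℝ → ℝ × ℝ → ℝ≥0∞ := fun z p =>
    ENNReal.ofReal ((α * (z - h (√s * z + p.1, f z)) - β * p.2) ^ 2)
  have hG : Measurable (fun q : ℝ × ℝ × ℝ => G q.1 q.2) := by fun_prop
  -- For each fixed `w` the estimator is admissible, so averaging over `w` keeps the bound: external
  -- randomness does not help.
  have h1 : ENNReal.ofReal (gmmse f (s + t)) ≤
      ∫⁻ w, ∫⁻ ω : ℝ × ℝ, G ω.1 (c * ω.2 + d * w, d * ω.2 - c * w) ∂gauss2 ∂(gaussianReal 0 1) := by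
    calc ENNReal.ofReal (gmmse f (s + t)) =
        ∫⁻ _w, ENNReal.ofReal (gmmse f (s + t)) ∂(gaussianReal 0 1) := by simp
      _ ≤ _ := lintegral_mono fun w => (hle w).trans (le_of_eq ?_)
    refine lintegral_congr fun ω => ?_
    congr 2
    have e1 : c * (√(s + t) * ω.1 + ω.2) + d * w = √s * ω.1 + (c * ω.2 + d * w) := by
      rw [← hc']; ring
    simp only [est, e1]
    linear_combination (-ω.1) * hαβ + (-β * ω.1) * hd'
  have h2 : ∫⁻ w, ∫⁻ ω : ℝ × ℝ, G ω.1 (c * ω.2 + d * w, d * ω.2 - c * w) ∂gauss2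
      ∂(gaussianReal 0 1) = ∫⁻ z, ∫⁻ p, G z p ∂gauss2 ∂(gaussianReal 0 1) := by
    rw [lintegral_lintegral_swap (by fun_prop), lintegral_prod _ (by fun_prop)]
    refine lintegral_congr fun z => ?_
    have := (measurePreserving_reflection_gauss2 hcd).lintegral_comp (f := G z) (by fun_prop)
    rw [← this, lintegral_prod _ (by fun_prop)]
  have h3 : ∫⁻ z, ∫⁻ p, G z p ∂gauss2 ∂(gaussianReal 0 1) =
      ENNReal.ofReal (α ^ 2 * gmmse f s + β ^ 2) := by
    have : ∀ z, ∫⁻ p, G z p ∂gauss2 = ∫⁻ n, (ENNReal.ofReal (α ^ 2) *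
        ENNReal.ofReal ((z - h (√s * z + n, f z)) ^ 2) + ENNReal.ofReal (β ^ 2))
          ∂(gaussianReal 0 1) := by
      intro z
      rw [lintegral_prod _ (by fun_prop)]
      refine lintegral_congr fun n => ?_
      have := lintegral_affine_sq_gaussian (α * (z - h (√s * z + n, f z))) (-β)
      rw [← ENNReal.ofReal_mul (sq_nonneg α), ← ENNReal.ofReal_add (by positivity) (by positivity),
        ← mul_pow, ← neg_sq β, ← this]
      refine lintegral_congr fun x => ?_
      simp only [G]
      congr 2; ring
    simp_rw [this]
    rw [← lintegral_prod (f := fun ω : ℝ × ℝ => (ENNReal.ofReal (α ^ 2) *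
        ENNReal.ofReal ((ω.1 - h (√s * ω.1 + ω.2, f ω.1)) ^ 2) + ENNReal.ofReal (β ^ 2)))
        (by fun_prop), lintegral_add_right _ (by fun_prop), lintegral_const_mul _ (by fun_prop)]
    have he' : ∫⁻ ω : ℝ × ℝ, ENNReal.ofReal ((ω.1 - h (√s * ω.1 + ω.2, f ω.1)) ^ 2) ∂gauss2 =
      ENNReal.ofReal (gmmse f s) := he
    rw [he', ENNReal.ofReal_add (mul_nonneg (sq_nonneg _) (gmmse_nonneg f s)) (sq_nonneg _),
      ENNReal.ofReal_mul (sq_nonneg α)]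
    simp
  rw [h2, h3] at h1
  exact (ENNReal.ofReal_le_ofReal_iff
    (by have := gmmse_nonneg f s; positivity)).1 h1

/-- Inverse-variance weights minimise the bound of `gmmse_add_le_combination`. In reciprocal form:
`1/mmse(s+t) ≥ 1/mmse(s) + t` when the MMSE is positive. -/
lemma gmmse_add_le {f : ℝ → ℝ} (hf : Measurable f) {s t : ℝ} (hs : 0 ≤ s) (ht : 0 < t) :
    gmmse f (s + t) ≤ gmmse f s / (1 + t * gmmse f s) := by
  have hm := gmmse_nonneg f s
  set m := gmmse f s
  have hp : 0 < 1 + t * m := by positivity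
  have hst : √t * √t = t := Real.mul_self_sqrt ht.le
  have h := gmmse_add_le_combination hf hs ht (α := 1 / (1 + t * m)) (β := √t * m / (1 + t * m))
    (by field_simp; linear_combination m * hst)
  refine h.trans (le_of_eq ?_)
  field_simp
  rw [Real.sq_sqrt ht.le]
  ring

lemma sqInt_eq_eLpNorm_sq {Ω : Type*} [MeasurableSpace Ω] (μ : Measure Ω) (X : Ω → ℝ) :
    sqInt μ X = eLpNorm X 2 μ ^ 2 := by
  rw [eLpNorm_eq_lintegral_rpow_enorm_toReal (by simp) (by simp), ← ENNReal.rpow_natCast,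
    ← ENNReal.rpow_mul]
  simp only [ENNReal.toReal_ofNat, Nat.cast_ofNat, one_div, ne_eq, OfNat.ofNat_ne_zero,
    not_false_eq_true, inv_mul_cancel₀, ENNReal.rpow_one]
  refine lintegral_congr fun ω => ?_
  rw [← sq_abs, ENNReal.ofReal_pow (abs_nonneg _), ← Real.norm_eq_abs, ofReal_norm,
    ENNReal.rpow_ofNat]

/-- Bounded continuous functions are dense in `L²` of the law of the observation, so the optimal
estimator can be approximated by one whose error is continuous in `s`. -/
lemma exists_boundedContinuous_estErr_lt {f : ℝ → ℝ} (hf : Measurable f) (s : ℝ) {ε : ℝ}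
    (hε : 0 < ε) : ∃ g : BoundedContinuousFunction (ℝ × ℝ) ℝ,
      estErr f s g < ENNReal.ofReal (gmmse f s + ε) := by
  obtain ⟨h, hh, he, hL⟩ := exists_estErr_eq_gmmse f s
  have hO := measurable_obs hf s
  set O := (fun ω : ℝ × ℝ => (√s * ω.1 + ω.2, f ω.1))
  have hL' : MemLp h 2 (gauss2.map O) := by
    rw [memLp_map_measure_iff hh.aestronglyMeasurable hO.aemeasurable]
    exact hL
  have : IsProbabilityMeasure (gauss2.map O) := Measure.isProbabilityMeasure_map hO.aemeasurable
  have hlt : estErr f s h < ENNReal.ofReal (gmmse f s + ε) := by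
    rw [he]
    exact (ENNReal.ofReal_lt_ofReal_iff (by have := gmmse_nonneg f s; linarith)).2 (by linarith)
  unfold estErr at hlt
  rw [sqInt_eq_eLpNorm_sq] at hlt
  set A := eLpNorm (fun ω : ℝ × ℝ => ω.1 - h (√s * ω.1 + ω.2, f ω.1)) 2 gauss2 with hA
  have hcont : Tendsto (fun e : ℝ≥0∞ => (A + e) ^ 2) (𝓝 0) (𝓝 ((A + 0) ^ 2)) :=
    ((ENNReal.continuous_pow 2).comp (continuous_const.add continuous_id)).tendsto 0
  rw [add_zero] at hcont
  have hev := hcont.eventually_lt_const hlt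
  obtain ⟨e, he0, hee⟩ : ∃ e : ℝ≥0∞, 0 < e ∧ (A + e) ^ 2 < ENNReal.ofReal (gmmse f s + ε) := by
    have h2 : ∀ᶠ e : ℝ≥0∞ in 𝓝[>] 0, (A + e) ^ 2 < ENNReal.ofReal (gmmse f s + ε) :=
      hev.filter_mono nhdsWithin_le_nhds
    obtain ⟨e, h1, h2⟩ := (h2.and self_mem_nhdsWithin).exists
    exact ⟨e, h2, h1⟩
  obtain ⟨g, hg, hgL⟩ := hL'.exists_boundedContinuous_eLpNorm_sub_le (by simp) he0.ne'
  refine ⟨g, lt_of_le_of_lt ?_ hee⟩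
  unfold estErr
  rw [sqInt_eq_eLpNorm_sq]
  gcongr
  have hg' : eLpNorm (fun ω : ℝ × ℝ => h (O ω) - g (O ω)) 2 gauss2 ≤ e := by
    rw [eLpNorm_map_measure (hh.aestronglyMeasurable.sub
      g.continuous.measurable.aestronglyMeasurable) hO.aemeasurable] at hg
    exact hg
  have hgm : Measurable g := g.continuous.measurable
  refine le_trans ?_ (add_le_add_right hg' A)
  have := eLpNorm_add_le (μ := gauss2) (p := 2)
    (f := fun ω : ℝ × ℝ => ω.1 - h (O ω)) (g := fun ω : ℝ × ℝ => h (O ω) - g (O ω))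
    (by fun_prop) (by fun_prop) one_le_two
  refine le_trans (le_of_eq ?_) this
  congr 1
  funext ω
  simp [O]

lemma tendsto_estErr {f : ℝ → ℝ} (hf : Measurable f) (s : ℝ)
    (g : BoundedContinuousFunction (ℝ × ℝ) ℝ) :
    Tendsto (fun s' => estErr f s' g) (𝓝 s) (𝓝 (estErr f s g)) := by
  have hgm : Measurable g := g.continuous.measurable
  refine tendsto_lintegral_filter_of_dominated_convergence
    (fun ω => ENNReal.ofReal (2 * ω.1 ^ 2 + 2 * ‖g‖ ^ 2)) ?_ ?_ ?_ ?_
  · exact Eventually.of_forall fun s' => by fun_prop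
  · refine Eventually.of_forall fun s' => ae_of_all _ fun ω => ENNReal.ofReal_le_ofReal ?_
    have h1 := g.norm_coe_le_norm (√s' * ω.1 + ω.2, f ω.1)
    set y := g (√s' * ω.1 + ω.2, f ω.1)
    have h2 : y ^ 2 ≤ ‖g‖ ^ 2 := by rw [← sq_abs y]; gcongr; exact h1
    nlinarith [sq_nonneg (ω.1 + y)]
  · have : Integrable (fun ω : ℝ × ℝ => 2 * ω.1 ^ 2 + 2 * ‖g‖ ^ 2) gauss2 :=
      (memLp_fst_gauss2.integrable_sq.const_mul 2).add (integrable_const _)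
    exact this.lintegral_lt_top.ne
  · refine ae_of_all _ fun ω => ENNReal.tendsto_ofReal ?_
    have hc : Continuous fun s' : ℝ => (ω.1 - g (√s' * ω.1 + ω.2, f ω.1)) ^ 2 := by fun_prop
    exact hc.tendsto s

/-- Upper semicontinuity: one fixed near-optimal bounded continuous estimator serves all nearby
ratios. -/
lemma eventually_gmmse_lt {f : ℝ → ℝ} (hf : Measurable f) (s : ℝ) {ε : ℝ} (hε : 0 < ε) :
    ∀ᶠ s' in 𝓝 s, gmmse f s' < gmmse f s + ε := by
  obtain ⟨g, hg⟩ := exists_boundedContinuous_estErr_lt hf s hε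
  filter_upwards [(tendsto_estErr hf s g).eventually_lt_const hg] with s' hs'
  have := (gmmse_le_estErr hf s' g.continuous.measurable).trans_lt hs'
  exact (ENNReal.ofReal_lt_ofReal_iff (by have := gmmse_nonneg f s; linarith)).1 this

/-! ### Monotonicity and one-sided continuity of `φ` and of the MMSE. -/

lemma IsAdmissible.measurable {f : ℝ → ℝ} (hf : IsAdmissible f) : Measurable f := by
  obtain ⟨K, I, hI, -, hU, hc⟩ := hf.pieces
  intro t ht
  have : f ⁻¹' t = ⋃ k, (I k ∩ f ⁻¹' t) := by
    rw [← iUnion_inter, hU, univ_inter]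
  rw [this]
  refine MeasurableSet.iUnion fun k => ?_
  have hm : MeasurableSet (I k) := (hI k).measurableSet
  have hr : Measurable ((I k).domRestrict f) :=
    (continuousOn_iff_continuous_domRestrict.1 (hc k).1.continuousOn).measurable
  have := hm.subtype_image (hr ht)
  rwa [show Subtype.val '' ((I k).domRestrict f ⁻¹' t) = I k ∩ f ⁻¹' t by
    ext x; simp [Set.domRestrict, and_comm]] at this

/-- The reciprocal of the state evolution map `φ`. -/
def psi (f : ℝ → ℝ) (v : ℝ) : ℝ := (mmseZ f v)⁻¹ - v⁻¹

lemma gmmse_add_le_self {f : ℝ → ℝ} (hf : Measurable f) {s t : ℝ} (hs : 0 ≤ s) (ht : 0 < t) :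
    gmmse f (s + t) ≤ gmmse f s := by
  have hm := gmmse_nonneg f s
  refine (gmmse_add_le hf hs ht).trans (div_le_self hm ?_)
  nlinarith [mul_nonneg ht.le hm]

lemma mmseZ_mono {f : ℝ → ℝ} (hf : Measurable f) {v w : ℝ} (hv : 0 < v) (hvw : v ≤ w)
    (hw : w ≤ 1) : mmseZ f v ≤ mmseZ f w := by
  rcases hvw.eq_or_lt with rfl | h
  · exact le_rfl
  have h1 : w⁻¹ < v⁻¹ := inv_strictAnti₀ hv h
  have h2 : 1 ≤ w⁻¹ := (one_le_inv₀ (hv.trans h)).2 hw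
  have := gmmse_add_le_self hf (s := w⁻¹ - 1) (t := v⁻¹ - w⁻¹) (by linarith) (by linarith)
  rwa [show w⁻¹ - 1 + (v⁻¹ - w⁻¹) = v⁻¹ - 1 by ring] at this

/-- This is the reciprocal form of `gmmse_add_le` with `s = 1/w - 1` and `t = 1/v - 1/w`. -/
lemma psi_antitone {f : ℝ → ℝ} (hf : Measurable f) {v w : ℝ} (hv : 0 < v) (hvw : v ≤ w)
    (hw : w ≤ 1) (hpos : 0 < mmseZ f v) : psi f w ≤ psi f v := by
  rcases hvw.eq_or_lt with rfl | h
  · exact le_rfl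
  have h1 : w⁻¹ < v⁻¹ := inv_strictAnti₀ hv h
  have h2 : 1 ≤ w⁻¹ := (one_le_inv₀ (hv.trans h)).2 hw
  have hle := gmmse_add_le hf (s := w⁻¹ - 1) (t := v⁻¹ - w⁻¹) (by linarith) (by linarith)
  rw [show w⁻¹ - 1 + (v⁻¹ - w⁻¹) = v⁻¹ - 1 by ring] at hle
  have hwpos : 0 < mmseZ f w := hpos.trans_le (mmseZ_mono hf hv hvw hw)
  change mmseZ f v ≤ mmseZ f w / (1 + (v⁻¹ - w⁻¹) * mmseZ f w) at hle
  have hp : 0 < 1 + (v⁻¹ - w⁻¹) * mmseZ f w := by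
    have := mul_pos (sub_pos.2 h1) hwpos; linarith
  have := inv_anti₀ hpos hle
  rw [inv_div, add_div, mul_div_assoc, div_self hwpos.ne'] at this
  unfold psi
  rw [one_div] at this
  linarith

lemma psi_nonneg {f : ℝ → ℝ} (hf : Measurable f) {v : ℝ} (hv : 0 < v) (hv1 : v ≤ 1)
    (hpos : 0 < mmseZ f v) : 0 ≤ psi f v :=
  sub_nonneg.2 (inv_anti₀ hpos (mmseZ_le_self hf hv hv1))

lemma phi_of_mmseZ_pos {f : ℝ → ℝ} {v : ℝ} (hv : 0 < v)
    (hpos : 0 < mmseZ f v) : phi f v = (ENNReal.ofReal (psi f v))⁻¹ := by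
  unfold phi psi
  rw [if_neg hv.ne', ENNReal.ofReal_sub _ (inv_nonneg.2 hv.le), ENNReal.ofReal_inv_of_pos hpos,
    ENNReal.ofReal_inv_of_pos hv]

lemma phi_of_mmseZ_eq_zero {f : ℝ → ℝ} {v : ℝ} (hv : 0 < v) (h0 : mmseZ f v = 0) :
    phi f v = 0 := by
  unfold phi
  rw [if_neg hv.ne', h0, ← ENNReal.ofReal_inv_of_pos hv]
  simp

lemma phi_mono {f : ℝ → ℝ} (hf : Measurable f) {v w : ℝ} (hv : 0 < v) (hvw : v ≤ w)
    (hw : w ≤ 1) : phi f v ≤ phi f w := by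
  rcases (mmseZ_nonneg f v).eq_or_lt with h | h
  · rw [phi_of_mmseZ_eq_zero hv h.symm]; exact zero_le
  · rw [phi_of_mmseZ_pos hv h, phi_of_mmseZ_pos (hv.trans_le hvw)
      (h.trans_le (mmseZ_mono hf hv hvw hw))]
    exact ENNReal.inv_le_inv.2 (ENNReal.ofReal_le_ofReal (psi_antitone hf hv hvw hw h))

/-- Monotonicity makes the right limit exist as an infimum, so the `limUnder` in `phi` is a genuine
limit. -/
lemma tendsto_phi_zero {f : ℝ → ℝ} (hf : Measurable f) :
    Tendsto (phi f) (𝓝[>] 0) (𝓝 (phi f 0)) ∧ phi f 0 = sInf (phi f '' Ioo 0 1) := by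
  have hm : MonotoneOn (phi f) (Ioo (0 : ℝ) 1) := fun v hv w hw hvw => phi_mono hf hv.1 hvw hw.2.le
  have ht := hm.tendsto_nhdsWithin_Ioo_right (nonempty_Ioo.2 one_pos) (OrderBot.bddBelow _)
  have h0 : phi f 0 = sInf (phi f '' Ioo 0 1) := by
    conv_lhs => unfold phi
    rw [if_pos rfl]
    refine Tendsto.limUnder_eq (ht.congr' ?_)
    filter_upwards [self_mem_nhdsWithin] with w (hw : 0 < w)
    simp only [phi, if_neg hw.ne']
  rw [h0]
  exact ⟨ht, rfl⟩

lemma phi_monotoneOn {f : ℝ → ℝ} (hf : Measurable f) : MonotoneOn (phi f) (Icc 0 1) := by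
  intro v hv w hw hvw
  rcases hv.1.eq_or_lt with rfl | hv0
  · rcases hw.1.eq_or_lt with rfl | hw0
    · exact le_rfl
    · rw [(tendsto_phi_zero hf).2]
      have hmem : w / 2 ∈ Ioo (0 : ℝ) 1 := ⟨by linarith, by linarith [hw.2]⟩
      exact (sInf_le (mem_image_of_mem _ hmem)).trans (phi_mono hf hmem.1 (by linarith) hw.2)
  · exact phi_mono hf hv0 hvw hw.2

/-- Monotonicity bounds from below, upper semicontinuity from above. Approach from above suffices
because the state evolution decreases. -/
lemma tendsto_mmseZ {f : ℝ → ℝ} (hf : Measurable f) {V : ℝ} (hV : 0 < V) {u : ℕ → ℝ}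
    (hu : Tendsto u atTop (𝓝 V)) (hVu : ∀ n, V ≤ u n) (hu1 : ∀ n, u n ≤ 1) :
    Tendsto (fun n => mmseZ f (u n)) atTop (𝓝 (mmseZ f V)) := by
  rw [tendsto_order]
  refine ⟨fun a ha => Eventually.of_forall fun n => ha.trans_le (mmseZ_mono hf hV (hVu n) (hu1 n)),
    fun a ha => ?_⟩
  have hs : Tendsto (fun n => (u n)⁻¹ - 1) atTop (𝓝 (V⁻¹ - 1)) := (hu.inv₀ hV.ne').sub_const 1
  have := hs.eventually (eventually_gmmse_lt hf (V⁻¹ - 1) (sub_pos.2 ha))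
  filter_upwards [this] with n hn
  have : mmseZ f (u n) < mmseZ f V + (a - mmseZ f V) := hn
  linarith

/-! ### Spectra -/

/-- `E[λ / (1 + x λ)]` for `λ ∼ P`. -/
def harm (P : Measure ℝ) (x : ℝ) : ℝ := ∫ l, l / (1 + x * l) ∂P

section Spectrum

variable {δ : ℝ} {P : Measure ℝ}

lemma IsLimitingSpectrum.exists_bounds (hP : IsLimitingSpectrum δ P) :
    ∃ a b : ℝ, 0 < a ∧ ∀ᵐ l ∂P, l ∈ Icc a b := by
  obtain ⟨a, b, ha, h⟩ := hP.support
  exact ⟨a, b, ha, mem_ae_iff.2 h⟩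

lemma IsLimitingSpectrum.ae_pos (hP : IsLimitingSpectrum δ P) : ∀ᵐ l ∂P, 0 < l := by
  obtain ⟨a, b, ha, h⟩ := hP.exists_bounds
  filter_upwards [h] with l hl using ha.trans_le hl.1

lemma IsLimitingSpectrum.integrable_of_bound (hP : IsLimitingSpectrum δ P) {F : ℝ → ℝ}
    (hF : Measurable F) (hb : ∀ l, 0 < l → |F l| ≤ l) : Integrable F P := by
  have := hP.prob
  obtain ⟨a, b, ha, h⟩ := hP.exists_bounds
  refine Integrable.of_bound hF.aestronglyMeasurable b ?_
  filter_upwards [h] with l hl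
  exact (hb l (ha.trans_le hl.1)).trans hl.2

lemma harm_integrand_le {x l : ℝ} (hx : 0 ≤ x) (hl : 0 < l) : |l / (1 + x * l)| ≤ l := by
  rw [abs_of_nonneg (by positivity)]
  exact div_le_self hl.le (by nlinarith [mul_nonneg hx hl.le])

lemma IsLimitingSpectrum.integrable_harm (hP : IsLimitingSpectrum δ P) {x : ℝ} (hx : 0 ≤ x) :
    Integrable (fun l => l / (1 + x * l)) P :=
  hP.integrable_of_bound (by fun_prop) fun _ hl => harm_integrand_le hx hl

lemma IsLimitingSpectrum.harm_pos (hP : IsLimitingSpectrum δ P) {x : ℝ} (hx : 0 ≤ x) :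
    0 < harm P x := by
  have := hP.prob
  have hpos : ∀ᵐ l ∂P, 0 < l / (1 + x * l) := by
    filter_upwards [hP.ae_pos] with l hl
    positivity
  refine (integral_pos_iff_support_of_nonneg_ae (hpos.mono fun _ h => h.le)
    (hP.integrable_harm hx)).2 ?_
  rw [pos_iff_ne_zero]
  intro h0
  have h1 : ∀ᵐ l ∂P, ¬ (l ∈ Function.support fun l => l / (1 + x * l)) := measure_eq_zero_iff_ae_notMem.1 h0
  obtain ⟨l, h2, h3⟩ := (h1.and hpos).exists
  exact h2 h3.ne'

lemma IsLimitingSpectrum.harm_zero (hP : IsLimitingSpectrum δ P) : harm P 0 = δ := by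
  simp [harm, hP.mean]

lemma IsLimitingSpectrum.mul_harm_le_one (hP : IsLimitingSpectrum δ P) {x : ℝ} (hx : 0 ≤ x) :
    x * harm P x ≤ 1 := by
  have := hP.prob
  unfold harm
  rw [← integral_const_mul]
  calc ∫ l, x * (l / (1 + x * l)) ∂P ≤ ∫ _l, (1 : ℝ) ∂P := by
        refine integral_mono_ae ((hP.integrable_harm hx).const_mul x) (integrable_const _) ?_
        filter_upwards [hP.ae_pos] with l hl
        have : 0 < 1 + x * l := by positivity
        rw [← mul_div_assoc, div_le_one this]
        linarith
    _ = 1 := by simp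

/-- With `y = l/(1+xl)` the new integrand is `y/(1+ty)`, which is concave in `y`; Jensen's
inequality is carried out with the tangent line at the mean `c`. -/
lemma IsLimitingSpectrum.harm_add_le (hP : IsLimitingSpectrum δ P) {x t : ℝ} (hx : 0 ≤ x)
    (ht : 0 ≤ t) : harm P (x + t) ≤ harm P x / (1 + t * harm P x) := by
  have := hP.prob
  have hc := hP.harm_pos hx
  set c := harm P x with hcdef
  have hpc : 0 < 1 + t * c := by positivity
  have hi := hP.integrable_harm hx
  have hi2 : Integrable (fun l => c / (1 + t * c) + (l / (1 + x * l) - c) / (1 + t * c) ^ 2) P :=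
    (integrable_const _).add ((hi.sub (integrable_const c)).div_const _)
  have key : harm P (x + t) ≤
      ∫ l, (c / (1 + t * c) + (l / (1 + x * l) - c) / (1 + t * c) ^ 2) ∂P := by
    refine integral_mono_ae (hP.integrable_harm (by positivity)) hi2 ?_
    filter_upwards [hP.ae_pos] with l hl
    have h1 : 0 < 1 + x * l := by positivity
    set y := l / (1 + x * l) with hy
    have hy0 : 0 < y := by positivity
    have h2 : l / (1 + (x + t) * l) = y / (1 + t * y) := by
      rw [hy]; field_simp; ring
    have h3 : 0 < 1 + t * y := by positivity
    rw [h2]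
    have : c / (1 + t * c) + (y - c) / (1 + t * c) ^ 2 - y / (1 + t * y) =
        t * (y - c) ^ 2 / ((1 + t * c) ^ 2 * (1 + t * y)) := by
      field_simp; ring
    have h4 : 0 ≤ t * (y - c) ^ 2 / ((1 + t * c) ^ 2 * (1 + t * y)) := by positivity
    linarith
  refine key.trans (le_of_eq ?_)
  have hi3 : Integrable (fun l => (l / (1 + x * l) - c) / (1 + t * c) ^ 2) P :=
    (hi.sub (integrable_const c)).div_const _
  rw [integral_add (integrable_const _) hi3, integral_div _ (fun l => l / (1 + x * l) - c),
    integral_sub hi (integrable_const c)]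
  have : ∫ l, l / (1 + x * l) ∂P = c := rfl
  simp [this]

/-- By `harm_add_le`, `1/H` grows with slope at least `1`; the factor `δ > 1` outweighs the
subtracted `x`. -/
lemma IsLimitingSpectrum.prec_mono (hP : IsLimitingSpectrum δ P) (hδ : 1 < δ) {x y : ℝ}
    (hx : 0 ≤ x) (hxy : x ≤ y) : δ / harm P x - x ≤ δ / harm P y - y := by
  have h := hP.harm_add_le hx (sub_nonneg.2 hxy)
  rw [add_sub_cancel] at h
  have hc := hP.harm_pos hx
  have hc' := hP.harm_pos (hx.trans hxy)
  have ht := sub_nonneg.2 hxy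
  set t := y - x with htd
  have := inv_anti₀ hc' h
  rw [inv_div, add_div, mul_div_assoc, div_self hc.ne', mul_one] at this
  have h2 := mul_le_mul_of_nonneg_left this (by linarith : (0 : ℝ) ≤ δ)
  rw [div_eq_mul_inv, div_eq_mul_inv]
  rw [one_div] at h2
  nlinarith

lemma IsLimitingSpectrum.one_le_prec (hP : IsLimitingSpectrum δ P) (hδ : 1 < δ) {x : ℝ}
    (hx : 0 ≤ x) : 1 ≤ δ / harm P x - x := by
  have := hP.prec_mono hδ le_rfl hx
  rwa [hP.harm_zero, div_self (by linarith), sub_zero] at this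

lemma IsLimitingSpectrum.continuousOn_harm (hP : IsLimitingSpectrum δ P) :
    ContinuousOn (harm P) (Ici 0) := by
  have := hP.prob
  obtain ⟨a, b, ha, h⟩ := hP.exists_bounds
  refine continuousOn_of_dominated (bound := fun _ => b) ?_ ?_ (integrable_const b) ?_
  · intro x hx; exact (hP.integrable_harm hx).aestronglyMeasurable
  · intro x hx
    filter_upwards [h] with l hl
    exact (harm_integrand_le hx (ha.trans_le hl.1)).trans hl.2
  · filter_upwards [h] with l hl
    have hl0 := ha.trans_le hl.1
    refine ContinuousOn.div (by fun_prop) (by fun_prop) fun x (hx : 0 ≤ x) => ?_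
    positivity

/-- Every nonzero element of `[0,∞]` is the inverse of some real `x ≥ 0`, with `x = 0` giving `∞`.
In this parametrisation the extended-valued maps become real formulas in `harm`. -/
lemma IsLimitingSpectrum.meanHarm_eq (hP : IsLimitingSpectrum δ P) {x : ℝ} (hx : 0 ≤ x) :
    meanHarm P (ENNReal.ofReal x)⁻¹ = ENNReal.ofReal (harm P x) := by
  unfold harm meanHarm
  rw [ofReal_integral_eq_lintegral_ofReal (hP.integrable_harm hx)
    (by filter_upwards [hP.ae_pos] with l hl; simp only [Pi.zero_apply]; positivity)]
  refine lintegral_congr_ae ?_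
  filter_upwards [hP.ae_pos] with l hl
  rw [inv_inv, ← ENNReal.ofReal_inv_of_pos hl, ← ENNReal.ofReal_add hx (by positivity),
    ← ENNReal.ofReal_inv_of_pos (by positivity)]
  congr 1
  field_simp
  ring

lemma IsLimitingSpectrum.Phi_eq (hP : IsLimitingSpectrum δ P) (hδ : 1 < δ) {x : ℝ} (hx : 0 ≤ x) :
    Phi δ P (ENNReal.ofReal x)⁻¹ = (δ / harm P x - x)⁻¹ := by
  have hδ0 : 0 < δ := by linarith
  have hh := hP.harm_pos hx
  unfold Phi
  rw [if_neg (by simp), hP.meanHarm_eq hx, inv_inv, ← ENNReal.ofReal_inv_of_pos hδ0,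
    ← ENNReal.ofReal_mul (by positivity), ← ENNReal.ofReal_inv_of_pos (by positivity),
    ← ENNReal.ofReal_sub _ hx, ENNReal.toReal_inv, ENNReal.toReal_ofReal]
  · congr 2; field_simp
  · have := hP.one_le_prec hδ hx
    have h2 : (δ⁻¹ * harm P x)⁻¹ = δ / harm P x := by field_simp
    rw [h2]; linarith

lemma IsLimitingSpectrum.mse_eq (hP : IsLimitingSpectrum δ P) {x : ℝ} (hx : 0 ≤ x) :
    mse P (ENNReal.ofReal x)⁻¹ = 1 - x * harm P x := by
  have := hP.prob
  have hi := (hP.integrable_harm hx).const_mul x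
  have h1 : 1 - x * harm P x = ∫ l, (1 - x * (l / (1 + x * l))) ∂P := by
    rw [integral_sub (integrable_const _) hi, integral_const_mul]
    simp [harm]
  have hnn : ∀ᵐ l ∂P, 0 ≤ 1 - x * (l / (1 + x * l)) := by
    filter_upwards [hP.ae_pos] with l hl
    have : 0 < 1 + x * l := by positivity
    have e : 1 - x * (l / (1 + x * l)) = 1 / (1 + x * l) := by field_simp; ring
    rw [e]; positivity
  rw [h1, integral_eq_lintegral_of_nonneg_ae hnn ((integrable_const _).sub hi).aestronglyMeasurable]
  unfold mse
  congr 1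
  refine lintegral_congr_ae ?_
  filter_upwards [hP.ae_pos] with l hl
  have : 0 < 1 + x * l := by positivity
  rw [ENNReal.div_eq_inv_mul, inv_inv, ← ENNReal.ofReal_mul hx, ← ENNReal.ofReal_one,
    ← ENNReal.ofReal_add zero_le_one (by positivity), ← ENNReal.ofReal_inv_of_pos this]
  congr 1
  field_simp
  ring

lemma IsLimitingSpectrum.mse_zero (hP : IsLimitingSpectrum δ P) : mse P 0 = 0 := by
  unfold mse
  rw [lintegral_congr_ae (g := fun _ => 0)]
  · simp
  filter_upwards [hP.ae_pos] with l hl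
  rw [ENNReal.div_zero (by simpa using hl)]
  simp

lemma IsLimitingSpectrum.mse_mono (hP : IsLimitingSpectrum δ P) : Monotone (mse P) := by
  have := hP.prob
  intro w w' h
  refine ENNReal.toReal_mono ?_ (lintegral_mono fun l => ?_)
  · refine ne_top_of_le_ne_top (b := 1) (by simp) ?_
    calc _ ≤ ∫⁻ _l, 1 ∂P := lintegral_mono fun l => ENNReal.inv_le_one.2 le_self_add
      _ = 1 := by simp
  · exact ENNReal.inv_le_inv.2 (add_le_add_right (ENNReal.div_le_div_left h _) 1)

lemma exists_eq_inv_ofReal {w : ℝ≥0∞} (hw : w ≠ 0) : ∃ x : ℝ, 0 ≤ x ∧ w = (ENNReal.ofReal x)⁻¹ :=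
  ⟨w⁻¹.toReal, ENNReal.toReal_nonneg, by rw [ENNReal.ofReal_toReal (by simpa using hw), inv_inv]⟩

lemma Phi_zero (δ : ℝ) (P : Measure ℝ) : Phi δ P 0 = 0 := if_pos rfl

lemma Phi_nonneg (δ : ℝ) (P : Measure ℝ) (w : ℝ≥0∞) : 0 ≤ Phi δ P w := by
  unfold Phi; split_ifs
  · exact le_rfl
  · exact ENNReal.toReal_nonneg

lemma IsLimitingSpectrum.Phi_pos (hP : IsLimitingSpectrum δ P) (hδ : 1 < δ) {w : ℝ≥0∞}
    (hw : w ≠ 0) : 0 < Phi δ P w := by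
  obtain ⟨x, hx, rfl⟩ := exists_eq_inv_ofReal hw
  rw [hP.Phi_eq hδ hx]
  have := hP.one_le_prec hδ hx
  exact inv_pos.2 (by linarith)

lemma IsLimitingSpectrum.Phi_le_one (hP : IsLimitingSpectrum δ P) (hδ : 1 < δ) (w : ℝ≥0∞) :
    Phi δ P w ≤ 1 := by
  rcases eq_or_ne w 0 with rfl | hw
  · rw [Phi_zero]; exact zero_le_one
  obtain ⟨x, hx, rfl⟩ := exists_eq_inv_ofReal hw
  rw [hP.Phi_eq hδ hx]
  exact inv_le_one_of_one_le₀ (hP.one_le_prec hδ hx)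

lemma IsLimitingSpectrum.Phi_mono (hP : IsLimitingSpectrum δ P) (hδ : 1 < δ) :
    Monotone (Phi δ P) := by
  intro w w' h
  rcases eq_or_ne w 0 with rfl | hw
  · rw [Phi_zero]; exact Phi_nonneg _ _ _
  have hw' : w' ≠ 0 := fun h0 => hw (le_zero_iff.1 (h0 ▸ h))
  obtain ⟨x, hx, rfl⟩ := exists_eq_inv_ofReal hw
  obtain ⟨y, hy, rfl⟩ := exists_eq_inv_ofReal hw'
  rw [ENNReal.inv_le_inv] at h
  have hyx : y ≤ x := (ENNReal.ofReal_le_ofReal_iff hx).1 h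
  rw [hP.Phi_eq hδ hx, hP.Phi_eq hδ hy]
  exact inv_anti₀ (by linarith [hP.one_le_prec hδ hy]) (hP.prec_mono hδ hy hyx)

/-- Pointwise domination of the harmonic means gives domination of the state evolution maps. -/
lemma Phi_le_Phi {P₁ P₂ : Measure ℝ} (h₁ : IsLimitingSpectrum δ P₁)
    (h₂ : IsLimitingSpectrum δ P₂) (hδ : 1 < δ)
    (h : ∀ x, 0 ≤ x → harm P₁ x ≤ harm P₂ x) (w : ℝ≥0∞) : Phi δ P₁ w ≤ Phi δ P₂ w := by
  rcases eq_or_ne w 0 with rfl | hw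
  · rw [Phi_zero, Phi_zero]
  obtain ⟨x, hx, rfl⟩ := exists_eq_inv_ofReal hw
  rw [h₁.Phi_eq hδ hx, h₂.Phi_eq hδ hx]
  refine inv_anti₀ (by linarith [h₂.one_le_prec hδ hx]) ?_
  have := h₁.harm_pos hx
  gcongr
  exact h x hx

end Spectrum

/-! ### Quantiles and the Lorenz order -/

section Quantile

variable {P : Measure ℝ} [IsProbabilityMeasure P] {a b : ℝ}

lemma cdf_eq_zero_of_lt (h : ∀ᵐ l ∂P, l ∈ Icc a b) {x : ℝ} (hx : x < a) : cdf P x = 0 := by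
  rw [cdf_eq_real, measureReal_eq_zero_iff]
  refine measure_mono_null (fun y (hy : y ≤ x) => ?_) (mem_ae_iff.1 h)
  exact fun hy' => absurd hy'.1 (by linarith)

lemma cdf_eq_one_of_le (h : ∀ᵐ l ∂P, l ∈ Icc a b) {x : ℝ} (hx : b ≤ x) : cdf P x = 1 := by
  have : P (Iic x) = 1 := by
    rw [← prob_compl_eq_zero_iff measurableSet_Iic]
    refine measure_mono_null (fun y hy => ?_) (mem_ae_iff.1 h)
    simp only [mem_compl_iff, mem_Iic, not_le] at hy
    exact fun hy' => absurd hy'.2 (by linarith)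
  rw [cdf_eq_real, measureReal_def, this, ENNReal.toReal_one]

lemma bddAbove_quantile_set (h : ∀ᵐ l ∂P, l ∈ Icc a b) {y : ℝ} (hy : y < 1) :
    BddAbove {x : ℝ | cdf P x ≤ y} :=
  ⟨b, fun x (hx : cdf P x ≤ y) => by
    by_contra hbx
    rw [cdf_eq_one_of_le h (not_le.1 hbx).le] at hx
    linarith⟩

lemma nonempty_quantile_set (h : ∀ᵐ l ∂P, l ∈ Icc a b) {y : ℝ} (hy : 0 < y) :
    {x : ℝ | cdf P x ≤ y}.Nonempty :=
  ⟨a - 1, by simp only [mem_ofPred_eq]; rw [cdf_eq_zero_of_lt h (by linarith)]; exact hy.le⟩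

/-- The levels are kept inside `(0,1)`: for `y ≥ 1` the defining set is the whole line and `sSup`
takes its default value `0`. -/
lemma quantile_mem (h : ∀ᵐ l ∂P, l ∈ Icc a b) {y : ℝ} (hy : y ∈ Ioo (0 : ℝ) 1) :
    quantile P y ∈ Icc a b := by
  refine ⟨le_of_forall_lt fun c hc => ?_, csSup_le (nonempty_quantile_set h hy.1) fun x hx => ?_⟩
  · obtain ⟨d, hcd, hda⟩ := exists_between hc
    refine hcd.trans_le (le_csSup (bddAbove_quantile_set h hy.2) ?_)
    simp only [mem_ofPred_eq]
    rw [cdf_eq_zero_of_lt h hda]; exact hy.1.le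
  · by_contra hbx
    simp only [mem_ofPred_eq] at hx
    rw [cdf_eq_one_of_le h (not_le.1 hbx).le] at hx
    linarith [hy.2]

lemma quantile_monotoneOn (h : ∀ᵐ l ∂P, l ∈ Icc a b) : MonotoneOn (quantile P) (Ioo 0 1) :=
  fun _ hy _ hz hyz => csSup_le_csSup (bddAbove_quantile_set h hz.2)
    (nonempty_quantile_set h hy.1) fun _ hx => le_trans hx hyz

lemma aemeasurable_quantile (h : ∀ᵐ l ∂P, l ∈ Icc a b) :
    AEMeasurable (quantile P) (volume.restrict (Ioo 0 1)) :=
  aemeasurable_restrict_of_monotoneOn measurableSet_Ioo (quantile_monotoneOn h)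

lemma quantile_le_of_lt_cdf (h : ∀ᵐ l ∂P, l ∈ Icc a b) {x y : ℝ} (hy : 0 < y)
    (hxy : y < cdf P x) : quantile P y ≤ x := by
  refine csSup_le (nonempty_quantile_set h hy) fun z (hz : cdf P z ≤ y) => ?_
  by_contra hxz
  exact absurd (monotone_cdf P (not_le.1 hxz).le) (by linarith)

lemma le_cdf_of_quantile_le (h : ∀ᵐ l ∂P, l ∈ Icc a b) {x y : ℝ} (hy : y < 1)
    (hxy : quantile P y ≤ x) : y ≤ cdf P x := by
  by_contra hlt
  have hc : ContinuousWithinAt (cdf P) (Ici x) x := (cdf P).right_continuous x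
  have hev : ∀ᶠ z in 𝓝[>] x, cdf P z < y :=
    (hc.mono Ioi_subset_Ici_self).eventually_lt_const (not_le.1 hlt)
  obtain ⟨z, hz, hxz⟩ := (hev.and self_mem_nhdsWithin).exists
  have : z ≤ quantile P y := le_csSup (bddAbove_quantile_set h hy) hz.le
  exact absurd (this.trans hxy) (not_le.2 hxz)

/-- The levels in `(0,1)` whose quantile is at most `x` lie between the intervals `(0, F(x))` and
`(0, F(x)]`, up to the endpoint `1`, so they have measure `F(x)`. -/
lemma map_quantile (h : ∀ᵐ l ∂P, l ∈ Icc a b) :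
    (volume.restrict (Ioo (0 : ℝ) 1)).map (quantile P) = P := by
  have hq := aemeasurable_quantile h
  have : IsProbabilityMeasure (volume.restrict (Ioo (0 : ℝ) 1)) := ⟨by simp⟩
  have := Measure.isProbabilityMeasure_map hq
  refine Measure.ext_of_Iic _ _ fun x => ?_
  rw [Measure.map_apply_of_aemeasurable hq measurableSet_Iic, Measure.restrict_apply₀',
    ← ofReal_cdf]
  · refine le_antisymm ?_ ?_
    · calc volume (quantile P ⁻¹' Iic x ∩ Ioo 0 1) ≤ volume (Ioc 0 (cdf P x)) :=
            measure_mono fun y hy => ⟨hy.2.1, le_cdf_of_quantile_le h hy.2.2 hy.1⟩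
        _ = _ := by simp
    · calc ENNReal.ofReal (cdf P x) = volume (Ioo 0 (cdf P x)) := by simp
        _ ≤ volume (quantile P ⁻¹' Iic x ∩ Ioo 0 1) := measure_mono fun y hy =>
            ⟨quantile_le_of_lt_cdf h hy.1 hy.2, hy.1, hy.2.trans_le (cdf_le_one P x)⟩
  · exact measurableSet_Ioo.nullMeasurableSet

lemma integral_comp_quantile (h : ∀ᵐ l ∂P, l ∈ Icc a b) {F : ℝ → ℝ} (hF : Measurable F) :
    ∫ y in Ioo 0 1, F (quantile P y) = ∫ l, F l ∂P := by
  conv_rhs => rw [← map_quantile h]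
  rw [integral_map (aemeasurable_quantile h) hF.aestronglyMeasurable]

lemma ae_quantile_mem (h : ∀ᵐ l ∂P, l ∈ Icc a b) :
    ∀ᵐ y ∂(volume.restrict (Ioo (0 : ℝ) 1)), quantile P y ∈ Icc a b :=
  (ae_restrict_mem measurableSet_Ioo).mono fun _ hy => quantile_mem h hy

lemma integrable_quantile (h : ∀ᵐ l ∂P, l ∈ Icc a b) :
    IntegrableOn (quantile P) (Ioo 0 1) := by
  refine Integrable.of_bound (aemeasurable_quantile h).aestronglyMeasurable (max |a| |b|) ?_
  filter_upwards [ae_quantile_mem h] with y hy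
  exact abs_le_max_abs_abs hy.1 hy.2

end Quantile

lemma intervalIntegral_quantile (P : Measure ℝ) {u : ℝ} (hu : 0 ≤ u) :
    ∫ y in (0 : ℝ)..u, quantile P y = ∫ y in Ioo 0 u, quantile P y := by
  rw [intervalIntegral.integral_of_le hu, integral_Ioc_eq_integral_Ioo]

/-- An antitone nonnegative weight on `(0,1)` preserves the order of partial integrals. -/
lemma integral_antitone_mul_le {k Q₁ Q₂ : ℝ → ℝ} {C : ℝ} (hk : AntitoneOn k (Ioo 0 1))
    (hk0 : ∀ y ∈ Ioo (0 : ℝ) 1, 0 ≤ k y) (hkC : ∀ y ∈ Ioo (0 : ℝ) 1, k y ≤ C)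
    (h1 : IntegrableOn Q₁ (Ioo 0 1)) (h2 : IntegrableOn Q₂ (Ioo 0 1))
    (p1 : ∀ y ∈ Ioo (0 : ℝ) 1, 0 ≤ Q₁ y) (p2 : ∀ y ∈ Ioo (0 : ℝ) 1, 0 ≤ Q₂ y)
    (h : ∀ u ∈ Icc (0 : ℝ) 1, ∫ y in Ioo 0 u, Q₁ y ≤ ∫ y in Ioo 0 u, Q₂ y) :
    ∫ y in Ioo 0 1, k y * Q₁ y ≤ ∫ y in Ioo 0 1, k y * Q₂ y := by
  have hkm : AEMeasurable k (volume.restrict (Ioo (0 : ℝ) 1)) :=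
    aemeasurable_restrict_of_antitoneOn measurableSet_Ioo hk
  have hmem : ∀ᵐ y ∂(volume.restrict (Ioo (0 : ℝ) 1)), y ∈ Ioo (0 : ℝ) 1 :=
    ae_restrict_mem measurableSet_Ioo
  have hki : ∀ Q : ℝ → ℝ, IntegrableOn Q (Ioo 0 1) →
      IntegrableOn (fun y => k y * Q y) (Ioo 0 1) := fun Q hQ => by
    refine Integrable.bdd_mul (c := C) hQ hkm.aestronglyMeasurable ?_
    filter_upwards [hmem] with y hy
    rw [Real.norm_of_nonneg (hk0 y hy)]; exact hkC y hy
  -- Layer-cake formula for `k` under the measure `Q dy`: since `k` is antitone, each set `{k > t}`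
  -- is an initial interval up to its endpoint. For an empty set `sSup` is `0` and the interval is
  -- empty as well.
  have hrep : ∀ Q : ℝ → ℝ, IntegrableOn Q (Ioo 0 1) → (∀ y ∈ Ioo (0 : ℝ) 1, 0 ≤ Q y) →
      ENNReal.ofReal (∫ y in Ioo 0 1, k y * Q y) = ∫⁻ t in Ioi (0 : ℝ),
        ENNReal.ofReal (∫ y in Ioo 0 (sSup ({y | t < k y} ∩ Ioo 0 1)), Q y) := by
    intro Q hQ hQ0
    set ν := (volume.restrict (Ioo (0 : ℝ) 1)).withDensity (fun y => ENNReal.ofReal (Q y)) with hν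
    have hac : ν ≪ volume.restrict (Ioo (0 : ℝ) 1) := withDensity_absolutelyContinuous _ _
    have hQm : AEMeasurable (fun y => ENNReal.ofReal (Q y)) (volume.restrict (Ioo (0 : ℝ) 1)) :=
      hQ.aestronglyMeasurable.aemeasurable.ennreal_ofReal
    have e1 : ENNReal.ofReal (∫ y in Ioo 0 1, k y * Q y) = ∫⁻ y, ENNReal.ofReal (k y) ∂ν := by
      rw [ofReal_integral_eq_lintegral_ofReal (hki Q hQ)
        (hmem.mono fun y hy => mul_nonneg (hk0 y hy) (hQ0 y hy)),
        lintegral_withDensity_eq_lintegral_mul₀ hQm hkm.ennreal_ofReal]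
      refine lintegral_congr_ae (hmem.mono fun y hy => ?_)
      simp only [Pi.mul_apply]
      rw [ENNReal.ofReal_mul (hk0 y hy), mul_comm]
    rw [e1, lintegral_eq_lintegral_meas_lt ν (hac (hmem.mono hk0)) (hkm.mono_ac hac)]
    refine lintegral_congr fun t => ?_
    set B := {y | t < k y} ∩ Ioo (0 : ℝ) 1 with hB
    have hB1 : B ⊆ Ioc 0 (sSup B) := fun y hy =>
      ⟨hy.2.1, le_csSup ⟨1, fun z hz => hz.2.2.le⟩ hy⟩
    have hB2 : Ioo 0 (sSup B) ⊆ B := fun y hy => by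
      have hne : B.Nonempty := by
        by_contra hemp
        rw [not_nonempty_iff_eq_empty] at hemp
        rw [hemp, Real.sSup_empty] at hy
        exact absurd (hy.1.trans hy.2) (lt_irrefl _)
      obtain ⟨z, hz, hyz⟩ := exists_lt_of_lt_csSup hne hy.2
      have hy1 : y ∈ Ioo (0 : ℝ) 1 := ⟨hy.1, hyz.trans hz.2.2⟩
      exact ⟨lt_of_lt_of_le hz.1 (hk hy1 hz.2 hyz.le), hy1⟩
    have hBae : B =ᵐ[volume] Ioo 0 (sSup B) :=
      (hB1.eventuallyLE.trans Ioo_ae_eq_Ioc.symm.le).antisymm hB2.eventuallyLE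
    have hBn : NullMeasurableSet B := measurableSet_Ioo.nullMeasurableSet.congr hBae.symm
    have hs : Ioo 0 (sSup B) ⊆ Ioo (0 : ℝ) 1 := hB2.trans inter_subset_right
    have e2 : ν {y | t < k y} = ν B := by
      refine measure_congr ?_
      have : ∀ᵐ y ∂ν, y ∈ Ioo (0 : ℝ) 1 := hac hmem
      exact this.mono fun y hy => propext ⟨fun h => ⟨h, hy⟩, fun h => h.1⟩
    rw [e2, hν, withDensity_apply₀ _ (hBn.mono_ac Measure.absolutelyContinuous_restrict),
      Measure.restrict_restrict₀ (hBn.mono_ac Measure.absolutelyContinuous_restrict),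
      inter_eq_left.2 (inter_subset_right : B ⊆ Ioo 0 1), setLIntegral_congr hBae,
      ofReal_integral_eq_lintegral_ofReal (hQ.mono_set hs)]
    exact (ae_restrict_mem measurableSet_Ioo).mono fun y hy => hQ0 y (hs hy)
  have h0 : 0 ≤ ∫ y in Ioo 0 1, k y * Q₂ y :=
    setIntegral_nonneg measurableSet_Ioo fun y hy => mul_nonneg (hk0 y hy) (p2 y hy)
  rw [← ENNReal.ofReal_le_ofReal_iff h0, hrep Q₁ h1 p1, hrep Q₂ h2 p2]
  refine lintegral_mono fun t => ENNReal.ofReal_le_ofReal (h _ ⟨?_, ?_⟩)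
  · exact Real.sSup_nonneg fun y hy => hy.2.1.le
  · exact Real.sSup_le (fun y hy => hy.2.2.le) zero_le_one

/-! ### The Lorenz order and the functional `harm`. -/

section Lorenz

variable {δ : ℝ} {P₁ P₂ : Measure ℝ}

lemma IsLimitingSpectrum.integral_quantile {P : Measure ℝ} (hP : IsLimitingSpectrum δ P) :
    ∫ y in (0 : ℝ)..1, quantile P y = δ := by
  have := hP.prob
  obtain ⟨a, b, -, h⟩ := hP.exists_bounds
  rw [intervalIntegral_quantile _ zero_le_one, ← hP.mean]
  exact integral_comp_quantile h measurable_id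

lemma Spikier.integral_quantile_le (h₁ : IsLimitingSpectrum δ P₁) (h₂ : IsLimitingSpectrum δ P₂)
    (hδ : 1 < δ) (h : Spikier P₁ P₂) {u : ℝ} (hu : u ∈ Icc (0 : ℝ) 1) :
    ∫ y in Ioo 0 u, quantile P₁ y ≤ ∫ y in Ioo 0 u, quantile P₂ y := by
  have := h₁.prob
  have := h₂.prob
  have := h u hu
  unfold lorenzCurve at this
  rw [h₁.integral_quantile, h₂.integral_quantile, div_le_div_iff_of_pos_right (by linarith),
    intervalIntegral_quantile _ hu.1, intervalIntegral_quantile _ hu.1] at this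
  exact this

/-- For the concave function `h(l) = l/(1+xl)`, the tangent at `Q₂` gives `h(Q₂) - h(Q₁) ≥ h'(Q₂)(Q₂
- Q₁)`. The weight `k = h'(Q₂) = (1+xQ₂)⁻²` is antitone in the level, so `integral_antitone_mul_le`
makes the integral of the right side nonnegative. -/
lemma Spikier.harm_le (h₁ : IsLimitingSpectrum δ P₁) (h₂ : IsLimitingSpectrum δ P₂)
    (hδ : 1 < δ) (h : Spikier P₁ P₂) {x : ℝ} (hx : 0 ≤ x) : harm P₁ x ≤ harm P₂ x := by
  have := h₁.prob
  have := h₂.prob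
  obtain ⟨a₁, b₁, ha₁, hb₁⟩ := h₁.exists_bounds
  obtain ⟨a₂, b₂, ha₂, hb₂⟩ := h₂.exists_bounds
  set Q₁ := quantile P₁
  set Q₂ := quantile P₂
  have q1 : ∀ y ∈ Ioo (0 : ℝ) 1, 0 < Q₁ y := fun y hy => ha₁.trans_le (quantile_mem hb₁ hy).1
  have q2 : ∀ y ∈ Ioo (0 : ℝ) 1, 0 < Q₂ y := fun y hy => ha₂.trans_le (quantile_mem hb₂ hy).1
  set k : ℝ → ℝ := fun y => ((1 + x * Q₂ y) ^ 2)⁻¹ with hkdef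
  have hden : ∀ y ∈ Ioo (0 : ℝ) 1, 1 ≤ 1 + x * Q₂ y := fun y hy => by
    have := mul_nonneg hx (q2 y hy).le; linarith
  have hk : AntitoneOn k (Ioo 0 1) := fun y hy z hz hyz => by
    have h1 := hden y hy
    have h2 := quantile_monotoneOn hb₂ hy hz hyz
    simp only [hkdef]
    refine inv_anti₀ (by positivity) ?_
    gcongr
  have hk0 : ∀ y ∈ Ioo (0 : ℝ) 1, 0 ≤ k y := fun y hy => by positivity
  have hk1 : ∀ y ∈ Ioo (0 : ℝ) 1, k y ≤ 1 := fun y hy =>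
    inv_le_one_of_one_le₀ (one_le_pow₀ (hden y hy))
  have i1 : IntegrableOn Q₁ (Ioo 0 1) := integrable_quantile hb₁
  have i2 : IntegrableOn Q₂ (Ioo 0 1) := integrable_quantile hb₂
  have key := integral_antitone_mul_le hk hk0 hk1 i1 i2 (fun y hy => (q1 y hy).le)
    (fun y hy => (q2 y hy).le) fun u hu => h.integral_quantile_le h₁ h₂ hδ hu
  have hmem : ∀ᵐ y ∂(volume.restrict (Ioo (0 : ℝ) 1)), y ∈ Ioo (0 : ℝ) 1 :=
    ae_restrict_mem measurableSet_Ioo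
  have hkm : AEMeasurable k (volume.restrict (Ioo (0 : ℝ) 1)) :=
    aemeasurable_restrict_of_antitoneOn measurableSet_Ioo hk
  have hki : ∀ Q : ℝ → ℝ, IntegrableOn Q (Ioo 0 1) →
      IntegrableOn (fun y => k y * Q y) (Ioo 0 1) := fun Q hQ => by
    refine Integrable.bdd_mul (c := 1) hQ hkm.aestronglyMeasurable ?_
    filter_upwards [hmem] with y hy
    rw [Real.norm_of_nonneg (hk0 y hy)]; exact hk1 y hy
  have hFm : Measurable (fun l : ℝ => l / (1 + x * l)) := by fun_prop
  have hFi : ∀ (Q : ℝ → ℝ), IntegrableOn Q (Ioo 0 1) → (∀ y ∈ Ioo (0 : ℝ) 1, 0 < Q y) →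
      IntegrableOn (fun y => Q y / (1 + x * Q y)) (Ioo 0 1) := fun Q hQ hQ0 => by
    refine Integrable.mono hQ
      (hFm.comp_aemeasurable hQ.aestronglyMeasurable.aemeasurable).aestronglyMeasurable ?_
    filter_upwards [hmem] with y hy
    rw [Real.norm_eq_abs, Real.norm_eq_abs, abs_of_pos (hQ0 y hy)]
    exact harm_integrand_le hx (hQ0 y hy)
  unfold harm
  rw [← integral_comp_quantile hb₁ hFm, ← integral_comp_quantile hb₂ hFm, ← sub_nonneg,
    ← integral_sub (hFi Q₂ i2 q2) (hFi Q₁ i1 q1)]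
  rw [← sub_nonneg, ← integral_sub (hki Q₂ i2) (hki Q₁ i1)] at key
  refine key.trans (setIntegral_mono_on ((hki Q₂ i2).sub (hki Q₁ i1))
    ((hFi Q₂ i2 q2).sub (hFi Q₁ i1 q1)) measurableSet_Ioo fun y hy => ?_)
  have e1 := q1 y hy
  have e2 := q2 y hy
  simp only [hkdef]
  set p := Q₁ y
  set q := Q₂ y
  have d1 : 0 < 1 + x * p := by positivity
  have d2 : 0 < 1 + x * q := by positivity
  have : (q / (1 + x * q) - p / (1 + x * p)) -
      (((1 + x * q) ^ 2)⁻¹ * q - ((1 + x * q) ^ 2)⁻¹ * p) =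
      x * (q - p) ^ 2 / ((1 + x * q) ^ 2 * (1 + x * p)) := by
    field_simp; ring
  have h4 : 0 ≤ x * (q - p) ^ 2 / ((1 + x * q) ^ 2 * (1 + x * p)) := by positivity
  linarith

lemma isLimitingSpectrum_dirac (hδ : 0 < δ) : IsLimitingSpectrum δ (Measure.dirac δ) where
  prob := inferInstance
  support := ⟨δ, δ, hδ, by simp⟩
  mean := by simp

/-- The constant spectrum is the least spiky one. -/
lemma IsLimitingSpectrum.spikier_dirac {P : Measure ℝ} (hP : IsLimitingSpectrum δ P)
    (hδ : 0 < δ) : Spikier P (Measure.dirac δ) := by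
  intro u hu
  have hD := isLimitingSpectrum_dirac hδ
  have := hP.prob
  obtain ⟨a, b, ha, h⟩ := hP.exists_bounds
  unfold lorenzCurve
  rw [hP.integral_quantile, hD.integral_quantile]
  refine div_le_div_of_nonneg_right ?_ hδ.le
  have hDm : ∀ᵐ l ∂(Measure.dirac δ), l ∈ Icc δ δ := by simp [ae_dirac_eq]
  have hD1 : ∫ y in Ioo 0 u, quantile (Measure.dirac δ) y = u * δ := by
    rw [setIntegral_congr_fun (g := fun _ => δ) measurableSet_Ioo]
    · simp [hu.1]
    · intro y hy
      have := quantile_mem hDm ⟨hy.1, hy.2.trans_le hu.2⟩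
      simpa using this
  rw [intervalIntegral_quantile _ hu.1, intervalIntegral_quantile _ hu.1, hD1]
  rcases hu.2.eq_or_lt with rfl | hu1
  · rw [← intervalIntegral_quantile _ zero_le_one, hP.integral_quantile, one_mul]
  rcases hu.1.eq_or_lt with rfl | hu0
  · simp
  have hi := integrable_quantile h
  have hmono := quantile_monotoneOn h
  set Q := quantile P
  have hsplit : (∫ y in Ioo 0 u, Q y) + ∫ y in Ico u 1, Q y = δ := by
    rw [← hP.integral_quantile, intervalIntegral_quantile _ zero_le_one,
      ← Ioo_union_Ico_eq_Ioo hu0 hu1.le]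
    exact (setIntegral_union (Set.disjoint_left.2 fun y h1 h2 => absurd h1.2 (not_lt.2 h2.1))
      measurableSet_Ico (hi.mono_set (Ioo_subset_Ioo_right hu1.le))
      (hi.mono_set fun y hy => ⟨hu0.trans_le hy.1, hy.2⟩)).symm
  -- The mean of the increasing `Q` on `(0,u)` is at most `Q u`, which is at most its mean on
  -- `[u,1)`.
  have hA : ∫ y in Ioo 0 u, Q y ≤ u * Q u := by
    calc ∫ y in Ioo 0 u, Q y ≤ ∫ _y in Ioo 0 u, Q u := by
          refine setIntegral_mono_on (hi.mono_set (Ioo_subset_Ioo_right hu1.le))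
            (integrable_const _) measurableSet_Ioo fun y hy => ?_
          exact hmono ⟨hy.1, hy.2.trans hu1⟩ ⟨hu0, hu1⟩ hy.2.le
      _ = u * Q u := by simp [hu0.le]
  have hB : (1 - u) * Q u ≤ ∫ y in Ico u 1, Q y := by
    calc (1 - u) * Q u = ∫ _y in Ico u 1, Q u := by simp [hu1.le]
      _ ≤ _ := by
          refine setIntegral_mono_on (integrable_const _)
            (hi.mono_set fun y hy => ⟨hu0.trans_le hy.1, hy.2⟩) measurableSet_Ico fun y hy => ?_
          exact hmono ⟨hu0, hu1⟩ ⟨hu0.trans_le hy.1, hy.2⟩ hy.1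
  have h3 : (1 - u) * (∫ y in Ioo 0 u, Q y) ≤ (1 - u) * (u * Q u) :=
    mul_le_mul_of_nonneg_left hA (by linarith : 0 ≤ 1 - u)
  have h4 := mul_le_mul_of_nonneg_left hB hu0.le
  rw [← hsplit]
  linarith

end Lorenz

/-! ### Limits of the state evolution -/

section Evolution

variable {f : ℝ → ℝ} {δ : ℝ} {P : Measure ℝ}

lemma step_monotoneOn (hf : Measurable f) (hδ : 1 < δ) (hP : IsLimitingSpectrum δ P) :
    MonotoneOn (fun v => Phi δ P (phi f v)) (Icc 0 1) :=
  fun _ hv _ hw hvw => hP.Phi_mono hδ (phi_monotoneOn hf hv hw hvw)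

lemma seVr_mem (hδ : 1 < δ) (hP : IsLimitingSpectrum δ P) (t : ℕ) :
    seVr f δ P t ∈ Icc (0 : ℝ) 1 := by
  cases t with
  | zero => exact ⟨zero_le_one, le_rfl⟩
  | succ t => exact ⟨Phi_nonneg _ _ _, hP.Phi_le_one hδ _⟩

lemma seVr_antitone (hf : Measurable f) (hδ : 1 < δ) (hP : IsLimitingSpectrum δ P) :
    Antitone (seVr f δ P) := by
  refine antitone_nat_of_succ_le fun t => ?_
  induction t with
  | zero => exact hP.Phi_le_one hδ _
  | succ t ih => exact step_monotoneOn hf hδ hP (seVr_mem hδ hP _) (seVr_mem hδ hP _) ih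

lemma tendsto_seVr (hf : Measurable f) (hδ : 1 < δ) (hP : IsLimitingSpectrum δ P) :
    Tendsto (seVr f δ P) atTop (𝓝 (Vstar f δ P)) := by
  have hb : BddBelow (range (seVr f δ P)) :=
    ⟨0, by rintro _ ⟨t, rfl⟩; exact (seVr_mem hδ hP t).1⟩
  have h := tendsto_atTop_ciInf (seVr_antitone hf hδ hP) hb
  unfold Vstar
  rwa [h.limUnder_eq]

lemma Vstar_le_seVr (hf : Measurable f) (hδ : 1 < δ) (hP : IsLimitingSpectrum δ P) (t : ℕ) :
    Vstar f δ P ≤ seVr f δ P t :=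
  (seVr_antitone hf hδ hP).le_of_tendsto (tendsto_seVr hf hδ hP) t

lemma Vstar_mem (hf : Measurable f) (hδ : 1 < δ) (hP : IsLimitingSpectrum δ P) :
    Vstar f δ P ∈ Icc (0 : ℝ) 1 :=
  ⟨ge_of_tendsto' (tendsto_seVr hf hδ hP) fun t => (seVr_mem hδ hP t).1,
    Vstar_le_seVr hf hδ hP 0⟩

/-- The step is monotone and the iteration starts at the top value `1`, so a point which the step
does not lower stays below every iterate. -/
lemma le_Vstar (hf : Measurable f) (hδ : 1 < δ) (hP : IsLimitingSpectrum δ P) {v : ℝ}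
    (hv : v ∈ Icc (0 : ℝ) 1) (hle : v ≤ Phi δ P (phi f v)) : v ≤ Vstar f δ P := by
  refine ge_of_tendsto' (tendsto_seVr hf hδ hP) fun t => ?_
  induction t with
  | zero => exact hv.2
  | succ t ih => exact hle.trans (step_monotoneOn hf hδ hP hv (seVr_mem hδ hP t) ih)

lemma phi_ne_zero_iff {v : ℝ} (hv : 0 < v) : phi f v ≠ 0 ↔ 0 < mmseZ f v := by
  constructor
  · intro h
    refine (mmseZ_nonneg f v).lt_of_ne fun h0 => h (phi_of_mmseZ_eq_zero hv h0.symm)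
  · intro h
    rw [phi_of_mmseZ_pos hv h]
    simp

lemma step_eq (hf : Measurable f) (hδ : 1 < δ) (hP : IsLimitingSpectrum δ P) {v : ℝ} (hv : 0 < v)
    (hv1 : v ≤ 1) (hpos : 0 < mmseZ f v) :
    Phi δ P (phi f v) = (δ / harm P (psi f v) - psi f v)⁻¹ := by
  rw [phi_of_mmseZ_pos hv hpos, hP.Phi_eq hδ (psi_nonneg hf hv hv1 hpos)]

lemma mse_phi_eq (hf : Measurable f) (hP : IsLimitingSpectrum δ P) {v : ℝ} (hv : 0 < v)
    (hv1 : v ≤ 1) (hpos : 0 < mmseZ f v) :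
    mse P (phi f v) = 1 - psi f v * harm P (psi f v) := by
  rw [phi_of_mmseZ_pos hv hpos, hP.mse_eq (psi_nonneg hf hv hv1 hpos)]

lemma psi_add_inv (f : ℝ → ℝ) (v : ℝ) : psi f v + v⁻¹ = (mmseZ f v)⁻¹ := by
  unfold psi; ring

/-- A positive limit of the state evolution is a fixed point. -/
lemma step_Vstar (hf : Measurable f) (hδ : 1 < δ) (hP : IsLimitingSpectrum δ P)
    (hV : 0 < Vstar f δ P) :
    0 < mmseZ f (Vstar f δ P) ∧ Phi δ P (phi f (Vstar f δ P)) = Vstar f δ P := by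
  have hlim := tendsto_seVr hf hδ hP
  have hVu := Vstar_le_seVr hf hδ hP
  have hV1 := (Vstar_mem hf hδ hP).2
  have hu1 : ∀ t, seVr f δ P t ≤ 1 := fun t => (seVr_mem hδ hP t).2
  have hsucc : ∀ t, seVr f δ P (t + 1) = Phi δ P (phi f (seVr f δ P t)) := fun _ => rfl
  set V := Vstar f δ P
  set u := seVr f δ P
  have hu0 : ∀ t, 0 < u t := fun t => hV.trans_le (hVu t)
  have hm0 : ∀ t, 0 < mmseZ f (u t) := fun t => by
    rw [← phi_ne_zero_iff (hu0 t)]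
    intro h0
    have := hsucc t
    rw [h0, Phi_zero] at this
    exact (hu0 (t + 1)).ne' this
  have hstep : ∀ t, (u (t + 1))⁻¹ = δ / harm P (psi f (u t)) - psi f (u t) := fun t => by
    rw [hsucc t, step_eq hf hδ hP (hu0 t) (hu1 t) (hm0 t), inv_inv]
  have hψ0 : ∀ t, 0 ≤ psi f (u t) := fun t => psi_nonneg hf (hu0 t) (hu1 t) (hm0 t)
  have hmlim := tendsto_mmseZ hf hV hlim hVu hu1
  have hK : ∀ t, (V⁻¹ / (δ - 1) + V⁻¹)⁻¹ ≤ mmseZ f (u t) := fun t => by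
    have h1 : (u t)⁻¹ ≤ V⁻¹ := inv_anti₀ hV (hVu t)
    have h2 : (u (t + 1))⁻¹ ≤ V⁻¹ := inv_anti₀ hV (hVu (t + 1))
    have h3 : psi f (u t) ≤ V⁻¹ / (δ - 1) := by
      rw [le_div_iff₀ (by linarith)]
      have h4 := hP.mul_harm_le_one (hψ0 t)
      have h5 : δ * psi f (u t) ≤ δ / harm P (psi f (u t)) := by
        rw [le_div_iff₀ (hP.harm_pos (hψ0 t))]; nlinarith
      have := hstep t
      linarith
    rw [← inv_inv (mmseZ f (u t)), ← psi_add_inv]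
    refine inv_anti₀ ?_ (add_le_add h3 h1)
    have := hψ0 t; have := inv_pos.2 (hu0 t); linarith
  have hmpos : 0 < mmseZ f V := by
    refine lt_of_lt_of_le ?_ (ge_of_tendsto' hmlim hK)
    have : 0 < δ - 1 := by linarith
    positivity
  refine ⟨hmpos, ?_⟩
  have hψlim : Tendsto (fun t => psi f (u t)) atTop (𝓝 (psi f V)) :=
    (hmlim.inv₀ hmpos.ne').sub (hlim.inv₀ hV.ne')
  have hψV := psi_nonneg hf hV hV1 hmpos
  have hH : Tendsto (fun t => harm P (psi f (u t))) atTop (𝓝 (harm P (psi f V))) := by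
    have hc := hP.continuousOn_harm (psi f V) hψV
    exact hc.tendsto.comp (tendsto_nhdsWithin_iff.2 ⟨hψlim, Eventually.of_forall hψ0⟩)
  have hR : Tendsto (fun t => (u (t + 1))⁻¹) atTop
      (𝓝 (δ / harm P (psi f V) - psi f V)) := by
    simp_rw [hstep]
    exact (tendsto_const_nhds.div hH (hP.harm_pos hψV).ne').sub hψlim
  have hL : Tendsto (fun t => (u (t + 1))⁻¹) atTop (𝓝 V⁻¹) :=
    (hlim.comp (tendsto_add_atTop_nat 1)).inv₀ hV.ne'
  rw [step_eq hf hδ hP hV hV1 hmpos, ← tendsto_nhds_unique hL hR, inv_inv]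

lemma gFun_of_pos {v : ℝ} (hv : 0 < v) : gFun f δ v = 1 - δ * (1 - mmseZ f v / v) :=
  if_neg hv.ne'

lemma gFun_eq_one_sub {v : ℝ} (hv : 0 < v) (hpos : 0 < mmseZ f v) :
    gFun f δ v = 1 - psi f v * (δ * mmseZ f v) := by
  rw [gFun_of_pos hv]
  unfold psi
  field_simp

/-- Where the state evolution does not increase, the mean square error dominates `g`. -/
lemma gFun_le_mse (hf : Measurable f) (hδ : 1 < δ) (hP : IsLimitingSpectrum δ P) {v : ℝ}
    (hv : 0 < v) (hv1 : v ≤ 1) (h : Phi δ P (phi f v) ≤ v) : gFun f δ v ≤ mse P (phi f v) := by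
  rcases (mmseZ_nonneg f v).eq_or_lt with h0 | hpos
  · rw [gFun_of_pos hv, ← h0, phi_of_mmseZ_eq_zero hv h0.symm, hP.mse_zero]
    simp; linarith
  have hψ := psi_nonneg hf hv hv1 hpos
  rw [step_eq hf hδ hP hv hv1 hpos] at h
  have h1 := hP.one_le_prec hδ hψ
  have hH := hP.harm_pos hψ
  have h2 : v⁻¹ ≤ δ / harm P (psi f v) - psi f v := by
    rwa [inv_le_comm₀ (by linarith) hv] at h
  have h3 : (mmseZ f v)⁻¹ ≤ δ / harm P (psi f v) := by rw [← psi_add_inv]; linarith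
  have h4 : harm P (psi f v) ≤ δ * mmseZ f v := by
    rw [inv_le_iff_one_le_mul₀ hpos] at h3
    rw [div_mul_eq_mul_div, le_div_iff₀ hH] at h3
    linarith
  rw [gFun_eq_one_sub hv hpos, mse_phi_eq hf hP hv hv1 hpos]
  have := mul_le_mul_of_nonneg_left h4 hψ
  linarith

/-- The fixed-point equation reads `1/mmse = ψ + 1/v = δ/H(ψ)`. Inserting `H(ψ) = δ mmse` into `1 -
ψ H(ψ)` eliminates the spectrum. -/
lemma mse_eq_gFun (hf : Measurable f) (hδ : 1 < δ) (hP : IsLimitingSpectrum δ P) {v : ℝ}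
    (hv : 0 < v) (hv1 : v ≤ 1) (hpos : 0 < mmseZ f v) (h : Phi δ P (phi f v) = v) :
    mse P (phi f v) = gFun f δ v := by
  have hψ := psi_nonneg hf hv hv1 hpos
  rw [step_eq hf hδ hP hv hv1 hpos, inv_eq_iff_eq_inv] at h
  have hH := hP.harm_pos hψ
  have h3 : (mmseZ f v)⁻¹ = δ / harm P (psi f v) := by rw [← psi_add_inv]; linarith
  have h4 : harm P (psi f v) = δ * mmseZ f v := by
    rw [inv_eq_one_div, div_eq_div_iff hpos.ne' hH.ne'] at h3
    linarith
  rw [gFun_eq_one_sub hv hpos, mse_phi_eq hf hP hv hv1 hpos, h4]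

lemma mse_nonneg (P : Measure ℝ) (w : ℝ≥0∞) : 0 ≤ mse P w := ENNReal.toReal_nonneg

lemma mseStar_eq_GFun (hf : Measurable f) (hδ : 1 < δ) (hP : IsLimitingSpectrum δ P)
    (hV : 0 < Vstar f δ P) : mseStar f δ P = GFun f δ (Vstar f δ P) := by
  obtain ⟨hpos, hfix⟩ := step_Vstar hf hδ hP hV
  have h := mse_eq_gFun hf hδ hP hV (Vstar_mem hf hδ hP).2 hpos hfix
  have h0 := mse_nonneg P (phi f (Vstar f δ P))
  unfold GFun mseStar
  rw [← h, max_eq_left h0]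

/-- Otherwise the positive number `Φ(φ(0))` would bound all later iterates from below. -/
lemma phi_zero_of_Vstar_eq_zero (hf : Measurable f) (hδ : 1 < δ) (hP : IsLimitingSpectrum δ P)
    (hV : Vstar f δ P = 0) : phi f 0 = 0 := by
  by_contra h
  have h1 := hP.Phi_pos hδ h
  have h2 : ∀ t, Phi δ P (phi f 0) ≤ seVr f δ P (t + 1) := fun t =>
    step_monotoneOn hf hδ hP ⟨le_rfl, zero_le_one⟩ (seVr_mem hδ hP t) (seVr_mem hδ hP t).1
  have h3 := ge_of_tendsto' ((tendsto_seVr hf hδ hP).comp (tendsto_add_atTop_nat 1)) h2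
  rw [hV] at h3
  linarith

lemma mseStar_of_Vstar_eq_zero (hf : Measurable f) (hδ : 1 < δ) (hP : IsLimitingSpectrum δ P)
    (hV : Vstar f δ P = 0) : mseStar f δ P = 0 := by
  unfold mseStar
  rw [hV, phi_zero_of_Vstar_eq_zero hf hδ hP hV, hP.mse_zero]

lemma step_le_of_Vstar_eq_zero (hf : Measurable f) (hδ : 1 < δ) (hP : IsLimitingSpectrum δ P)
    (hV : Vstar f δ P = 0) {v : ℝ} (hv : v ∈ Ioc (0 : ℝ) 1) : Phi δ P (phi f v) ≤ v := by
  by_contra h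
  have := le_Vstar hf hδ hP ⟨hv.1.le, hv.2⟩ (not_le.1 h).le
  linarith [hv.1]

lemma IsLimitingSpectrum.tendsto_mse_zero (hP : IsLimitingSpectrum δ P) :
    Tendsto (mse P) (𝓝 0) (𝓝 0) := by
  have := hP.prob
  obtain ⟨a, b, ha, h⟩ := hP.exists_bounds
  have hle : ∀ w : ℝ≥0∞, w ≠ ∞ → mse P w ≤ (w / ENNReal.ofReal a).toReal := fun w hw => by
    refine ENNReal.toReal_mono (ENNReal.div_ne_top hw (by simpa using ha)) ?_
    calc ∫⁻ x, (1 + ENNReal.ofReal x / w)⁻¹ ∂P ≤ ∫⁻ _x, w / ENNReal.ofReal a ∂P := by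
          refine lintegral_mono_ae ?_
          filter_upwards [h] with l hl
          have e : (ENNReal.ofReal a / w)⁻¹ = w / ENNReal.ofReal a :=
            ENNReal.inv_div (Or.inl hw) (Or.inr (by simpa using ha))
          rw [← e]
          refine ENNReal.inv_le_inv.2 (le_trans ?_ le_add_self)
          exact ENNReal.div_le_div_right (ENNReal.ofReal_le_ofReal hl.1) _
      _ = _ := by simp
  have hlim : Tendsto (fun w : ℝ≥0∞ => (w / ENNReal.ofReal a).toReal) (𝓝 0) (𝓝 0) := by
    have h1 : Tendsto (fun w : ℝ≥0∞ => w / ENNReal.ofReal a) (𝓝 0) (𝓝 (0 / ENNReal.ofReal a)) :=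
      ENNReal.Tendsto.div_const tendsto_id (Or.inr (by simpa using ha))
    rw [ENNReal.zero_div] at h1
    have h2 := (ENNReal.tendsto_toReal ENNReal.zero_ne_top).comp h1
    rw [ENNReal.toReal_zero] at h2
    exact h2
  refine tendsto_of_tendsto_of_tendsto_of_le_of_le' tendsto_const_nhds hlim
    (Eventually.of_forall fun w => mse_nonneg P w) ?_
  filter_upwards [Iio_mem_nhds (ENNReal.zero_lt_top)] with w (hw : w < ∞)
  exact hle w hw.ne

/-- If the state evolution converges to zero, then `g` has nonpositive upper limit at zero. -/
lemma eventually_GFun_lt (hf : Measurable f) (hδ : 1 < δ) (hP : IsLimitingSpectrum δ P)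
    (hV : Vstar f δ P = 0) {ε : ℝ} (hε : 0 < ε) : ∀ᶠ v in 𝓝[>] (0 : ℝ), GFun f δ v < ε := by
  have h1 := (tendsto_phi_zero hf).1
  rw [phi_zero_of_Vstar_eq_zero hf hδ hP hV] at h1
  have h2 := (hP.tendsto_mse_zero.comp h1).eventually_lt_const hε
  filter_upwards [h2, Ioc_mem_nhdsGT (zero_lt_one' ℝ)] with v hv hv1
  exact max_lt ((gFun_le_mse hf hδ hP hv1.1 hv1.2
    (step_le_of_Vstar_eq_zero hf hδ hP hV hv1)).trans_lt hv) hε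

end Evolution

/-! ### Comparison of two spectra when `G` is monotonic. -/

section Comparison

variable {f : ℝ → ℝ} {δ : ℝ} {P₁ P₂ : Measure ℝ}

lemma Vstar_le_Vstar (hf : Measurable f) (hδ : 1 < δ) (h₁ : IsLimitingSpectrum δ P₁)
    (h₂ : IsLimitingSpectrum δ P₂) (h : Spikier P₁ P₂) : Vstar f δ P₁ ≤ Vstar f δ P₂ := by
  refine le_of_tendsto_of_tendsto' (tendsto_seVr hf hδ h₁) (tendsto_seVr hf hδ h₂) fun t => ?_
  induction t with
  | zero => exact le_rfl
  | succ t ih =>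
    exact (Phi_le_Phi h₁ h₂ hδ (fun x hx => h.harm_le h₁ h₂ hδ hx) _).trans
      (step_monotoneOn hf hδ h₂ (seVr_mem hδ h₁ t) (seVr_mem hδ h₂ t) ih)

lemma mseStar_nonneg (f : ℝ → ℝ) (δ : ℝ) (P : Measure ℝ) : 0 ≤ mseStar f δ P := mse_nonneg _ _

theorem mseStar_le_of_monotoneOn (hf : Measurable f) (hδ : 1 < δ) (h₁ : IsLimitingSpectrum δ P₁)
    (h₂ : IsLimitingSpectrum δ P₂) (h : Spikier P₁ P₂) (hG : MonotoneOn (GFun f δ) (Icc 0 1)) :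
    mseStar f δ P₁ ≤ mseStar f δ P₂ := by
  have hV := Vstar_le_Vstar hf hδ h₁ h₂ h
  have m₁ := Vstar_mem hf hδ h₁
  have m₂ := Vstar_mem hf hδ h₂
  rcases m₁.1.eq_or_lt with h0 | h0
  · rw [mseStar_of_Vstar_eq_zero hf hδ h₁ h0.symm]
    exact mseStar_nonneg _ _ _
  · rw [mseStar_eq_GFun hf hδ h₁ h0, mseStar_eq_GFun hf hδ h₂ (h0.trans_le hV)]
    exact hG m₁ m₂ hV

theorem mseStar_le_of_antitoneOn (hf : Measurable f) (hδ : 1 < δ) (h₁ : IsLimitingSpectrum δ P₁)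
    (h₂ : IsLimitingSpectrum δ P₂) (h : Spikier P₁ P₂) (hG : AntitoneOn (GFun f δ) (Icc 0 1)) :
    mseStar f δ P₂ ≤ mseStar f δ P₁ := by
  have hV := Vstar_le_Vstar hf hδ h₁ h₂ h
  have m₁ := Vstar_mem hf hδ h₁
  have m₂ := Vstar_mem hf hδ h₂
  rcases m₂.1.eq_or_lt with h0 | h0
  · rw [mseStar_of_Vstar_eq_zero hf hδ h₂ h0.symm]
    exact mseStar_nonneg _ _ _
  rw [mseStar_eq_GFun hf hδ h₂ h0]
  rcases m₁.1.eq_or_lt with h1 | h1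
  · rw [mseStar_of_Vstar_eq_zero hf hδ h₁ h1.symm]
    -- The zero limit does not identify the error with `G 0`; instead `G` is below any `ε` at some
    -- `v` in `(0, V₂]`, and antitonicity carries this bound to `V₂`.
    refine le_of_forall_pos_lt_add fun ε hε => ?_
    rw [zero_add]
    obtain ⟨v, hv, hv1⟩ := ((eventually_GFun_lt hf hδ h₁ h1.symm hε).and
      (Ioc_mem_nhdsGT h0)).exists
    exact (hG ⟨hv1.1.le, hv1.2.trans m₂.2⟩ m₂ hv1.2).trans_lt hv
  · rw [mseStar_eq_GFun hf hδ h₁ h1]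
    exact hG m₁ m₂ hV

end Comparison

/-! ### The indicator of a short interval -/

/-- The indicator function of `[0,r]`. -/
def boxInd (r : ℝ) : ℝ → ℝ := (Icc 0 r).indicator 1

lemma boxInd_of_mem {r z : ℝ} (h : z ∈ Icc 0 r) : boxInd r z = 1 := indicator_of_mem h _

lemma boxInd_of_notMem {r z : ℝ} (h : z ∉ Icc 0 r) : boxInd r z = 0 := indicator_of_notMem h _

lemma measurable_boxInd (r : ℝ) : Measurable (boxInd r) :=
  measurable_one.indicator measurableSet_Icc

/-- The Gaussian mass of `[0,r]`. -/
def boxMass (r : ℝ) : ℝ := (gaussianReal 0 1).real (Icc 0 r)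

lemma isAdmissible_boxInd {r : ℝ} (hr : 0 ≤ r) : IsAdmissible (boxInd r) where
  pieces := by
    refine ⟨3, ![Iio 0, Icc 0 r, Ioi r], ?_, ?_, ?_, ?_⟩
    · intro k; fin_cases k
      · exact ordConnected_Iio
      · exact ordConnected_Icc
      · exact ordConnected_Ioi
    · have h1 : Disjoint (Iio (0 : ℝ)) (Icc 0 r) :=
        Set.disjoint_left.2 fun x (hx : x < 0) hy => absurd hy.1 (not_le.2 hx)
      have h2 : Disjoint (Iio (0 : ℝ)) (Ioi r) :=
        Set.disjoint_left.2 fun x (hx : x < 0) (hy : r < x) => by linarith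
      have h3 : Disjoint (Icc 0 r) (Ioi r) :=
        Set.disjoint_left.2 fun x hx (hy : r < x) => absurd hx.2 (not_le.2 hy)
      intro i j hij
      fin_cases i <;> fin_cases j <;>
        first
          | exact absurd rfl hij
          | assumption
          | exact h1
          | exact h2
          | exact h3
          | exact h1.symm
          | exact h2.symm
          | exact h3.symm
    · refine eq_univ_of_forall fun x => ?_
      rw [mem_iUnion]
      rcases lt_or_ge x 0 with h | h
      · exact ⟨0, h⟩
      rcases le_or_gt x r with h' | h'
      · exact ⟨1, h, h'⟩
      · exact ⟨2, h'⟩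
    · intro k
      have hc : ∀ (I : Set ℝ) (c : ℝ), (∀ x ∈ I, boxInd r x = c) →
          ContDiffOn ℝ 1 (boxInd r) I ∧ (StrictMonoOn (boxInd r) I ∨ StrictAntiOn (boxInd r) I ∨
            ∃ c, ∀ x ∈ I, boxInd r x = c) := fun I c h =>
        ⟨contDiffOn_const.congr h, Or.inr (Or.inr ⟨c, h⟩)⟩
      fin_cases k
      · exact hc _ 0 fun x (hx : x < 0) => boxInd_of_notMem fun h => absurd h.1 (not_le.2 hx)
      · exact hc _ 1 fun x hx => boxInd_of_mem hx
      · exact hc _ 0 fun x (hx : r < x) => boxInd_of_notMem fun h => absurd h.2 (not_le.2 hx)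
  entropy := by
    refine summable_of_ne_finset_zero (s := {0, 1}) fun k hk => ?_
    have : {z : ℝ | ⌊boxInd r z⌋ = k} = ∅ := by
      refine eq_empty_of_forall_notMem fun z (hz : ⌊boxInd r z⌋ = k) => hk ?_
      by_cases h : z ∈ Icc 0 r
      · rw [boxInd_of_mem h] at hz; simp [← hz]
      · rw [boxInd_of_notMem h] at hz; simp [← hz]
    simp [this]

lemma gaussianReal_pos_of_isOpen {U : Set ℝ} (hU : IsOpen U) (hne : U.Nonempty) :
    0 < gaussianReal 0 1 U := by
  rw [pos_iff_ne_zero]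
  intro h
  exact (hU.measure_pos volume hne).ne' (gaussianReal_absolutelyContinuous' 0 one_ne_zero h)

lemma boxMass_pos {r : ℝ} (hr : 0 < r) : 0 < boxMass r := by
  refine ENNReal.toReal_pos ?_ (measure_ne_top _ _)
  exact ((gaussianReal_pos_of_isOpen isOpen_Ioo (nonempty_Ioo.2 hr)).trans_le
    (measure_mono Ioo_subset_Icc_self)).ne'

lemma gaussianReal_le_volume (A : Set ℝ) : gaussianReal 0 1 A ≤ volume A := by
  have hle : gaussianPDF 0 1 ≤ 1 := fun x => by
    rw [gaussianPDF_def, Pi.one_apply, ← ENNReal.ofReal_one]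
    refine ENNReal.ofReal_le_ofReal ?_
    rw [gaussianPDFReal_def]
    refine mul_le_one₀ (inv_le_one_of_one_le₀ ?_) (Real.exp_nonneg _) (Real.exp_le_one_iff.2 ?_)
    · rw [Real.one_le_sqrt]
      have := Real.pi_gt_three
      push_cast; linarith
    · exact div_nonpos_of_nonpos_of_nonneg (neg_nonpos.2 (sq_nonneg _)) (by positivity)
  calc gaussianReal 0 1 A = (volume.withDensity (gaussianPDF 0 1)) A := by
        rw [gaussianReal_of_var_ne_zero 0 one_ne_zero]
    _ ≤ (volume.withDensity 1) A := withDensity_mono (ae_of_all _ hle) A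
    _ = volume A := by rw [withDensity_one]

lemma boxMass_le {r : ℝ} (hr : 0 ≤ r) : boxMass r ≤ r := by
  refine ENNReal.toReal_le_of_le_ofReal hr ((gaussianReal_le_volume _).trans ?_)
  simp

/-- Change of variables and integration over the second coordinate. -/
lemma lintegral_combination_sq {a b : ℝ} (hab : b ^ 2 + a ^ 2 = 1) {A B : ℝ → ℝ}
    (hA : Measurable A) (hB : Measurable B) :
    ∫⁻ ω : ℝ × ℝ, ENNReal.ofReal ((A (b * ω.1 + a * ω.2) * (b * ω.1 + a * ω.2)
      + B (b * ω.1 + a * ω.2) * (a * ω.1 - b * ω.2)) ^ 2) ∂gauss2 =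
    ∫⁻ z, ENNReal.ofReal ((A z * z) ^ 2 + B z ^ 2) ∂(gaussianReal 0 1) := by
  have h1 := (measurePreserving_reflection_gauss2 hab).lintegral_comp
    (f := fun x : ℝ × ℝ => ENNReal.ofReal ((A x.1 * x.1 + B x.1 * x.2) ^ 2)) (by fun_prop)
  rw [h1, lintegral_prod _ (by fun_prop)]
  exact lintegral_congr fun z => lintegral_affine_sq_gaussian (A z * z) (B z)

lemma integrable_sq_gaussian : Integrable (fun x : ℝ => x ^ 2) (gaussianReal 0 1) :=
  (memLp_id_gaussianReal' 2 (by simp)).integrable_sq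

lemma integral_boxInd (r : ℝ) : ∫ z, boxInd r z ∂(gaussianReal 0 1) = boxMass r := by
  unfold boxInd boxMass
  rw [integral_indicator_one measurableSet_Icc]

lemma integrable_boxInd (r : ℝ) : Integrable (boxInd r) (gaussianReal 0 1) :=
  (integrable_const (1 : ℝ)).indicator measurableSet_Icc

/-- Given `Z ≈ 0`, one has `W ≈ -√(1-v) N'` and `M ≈ √v N'` for a Gaussian `N'` independent of `Z`.
The estimator `-(√v √(1-v)/2) M` on this event, and `0` off it, exploits the negative correlation;
it need not be optimal. -/
lemma mul_boxMass_le_one_sub {r v : ℝ} (hr : r ≤ 1 / 2) (hv : 0 < v) (hv1 : v ≤ 1) :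
    v * (1 - v) * boxMass r / 4 ≤ 1 - mmseZ (boxInd r) v / v := by
  have hm := measurable_boxInd r
  have ha : √v ^ 2 = v := Real.sq_sqrt hv.le
  have hb : √(1 - v) ^ 2 = 1 - v := Real.sq_sqrt (by linarith)
  have ha0 := Real.sqrt_nonneg v
  have hb0 := Real.sqrt_nonneg (1 - v)
  have hle := mmseZ_le_residErr hm hv hv1
    (h := fun p => -(√v * √(1 - v) / 2) * p.1 * p.2) (by fun_prop)
  unfold residErr sqInt at hle
  set a := √v
  set b := √(1 - v)
  have hab : b ^ 2 + a ^ 2 = 1 := by rw [ha, hb]; ring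
  set c := -(a * b / 2) with hc
  have e := lintegral_combination_sq hab
    (A := fun z => a - c * b * boxInd r z) (B := fun z => -b - c * a * boxInd r z)
    (by fun_prop) (by fun_prop)
  have e0 : ∫⁻ ω : ℝ × ℝ, ENNReal.ofReal
      ((ω.2 - c * ω.1 * boxInd r (b * ω.1 + a * ω.2)) ^ 2) ∂gauss2 =
      ∫⁻ z, ENNReal.ofReal (((a - c * b * boxInd r z) * z) ^ 2 + (-b - c * a * boxInd r z) ^ 2)
        ∂(gaussianReal 0 1) := by
    rw [← e]
    refine lintegral_congr fun ω => ?_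
    congr 2
    linear_combination (c * boxInd r (b * ω.1 + a * ω.2) * ω.1 - ω.2) * hab
  rw [e0] at hle
  have hi : Integrable (fun z => a ^ 2 * z ^ 2 + b ^ 2 - v * (1 - v) / 4 * boxInd r z)
      (gaussianReal 0 1) :=
    ((integrable_sq_gaussian.const_mul _).add (integrable_const _)).sub
      ((integrable_boxInd r).const_mul _)
  have hptw : ∀ z, ((a - c * b * boxInd r z) * z) ^ 2 + (-b - c * a * boxInd r z) ^ 2 ≤
      a ^ 2 * z ^ 2 + b ^ 2 - v * (1 - v) / 4 * boxInd r z := fun z => by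
    by_cases hz : z ∈ Icc 0 r
    · rw [boxInd_of_mem hz]
      have hz2 : z ^ 2 ≤ 1 / 4 := by nlinarith [hz.1, hz.2]
      have e1 : a ^ 2 * z ^ 2 + b ^ 2 - v * (1 - v) / 4 * 1 -
          (((a - c * b * 1) * z) ^ 2 + (-b - c * a * 1) ^ 2) =
          (a * b) ^ 2 * (1 - z ^ 2 - (b ^ 2 * z ^ 2 + a ^ 2) / 4) - v * (1 - v) / 4 := by
        rw [hc]; ring
      have e2 : (a * b) ^ 2 = v * (1 - v) := by rw [mul_pow, ha, hb]
      have h5 : 1 / 4 ≤ 1 - z ^ 2 - (b ^ 2 * z ^ 2 + a ^ 2) / 4 := by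
        rw [ha, hb]; nlinarith [sq_nonneg z]
      have h6 : 0 ≤ v * (1 - v) := mul_nonneg hv.le (by linarith)
      rw [e2] at e1
      nlinarith [mul_le_mul_of_nonneg_left h5 h6]
    · rw [boxInd_of_notMem hz]
      refine le_of_eq ?_
      ring
  have hnn : ∀ z, 0 ≤ a ^ 2 * z ^ 2 + b ^ 2 - v * (1 - v) / 4 * boxInd r z := fun z =>
    le_trans (by positivity) (hptw z)
  have hI : ∫ z, (a ^ 2 * z ^ 2 + b ^ 2 - v * (1 - v) / 4 * boxInd r z) ∂(gaussianReal 0 1) =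
      1 - v * (1 - v) / 4 * boxMass r := by
    have i1 : Integrable (fun z : ℝ => a ^ 2 * z ^ 2) (gaussianReal 0 1) :=
      integrable_sq_gaussian.const_mul _
    have i2 : Integrable (fun z : ℝ => a ^ 2 * z ^ 2 + b ^ 2) (gaussianReal 0 1) :=
      i1.add (integrable_const _)
    rw [integral_sub i2 ((integrable_boxInd r).const_mul _), integral_add i1 (integrable_const _),
      integral_const_mul, integral_const_mul, integral_sq_gaussian, integral_boxInd]
    simp only [integral_const, probReal_univ, smul_eq_mul]
    linear_combination hab
  have h2 : ENNReal.ofReal (mmseZ (boxInd r) v) ≤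
      ENNReal.ofReal (v * (1 - v * (1 - v) / 4 * boxMass r)) := by
    rw [ENNReal.ofReal_mul hv.le, ← hI, ofReal_integral_eq_lintegral_ofReal hi (ae_of_all _ hnn)]
    refine hle.trans ?_
    gcongr with z
    exact hptw z
  have h3 : 0 ≤ v * (1 - v * (1 - v) / 4 * boxMass r) := by
    rw [← hI]; exact mul_nonneg hv.le (integral_nonneg hnn)
  have h4 := (ENNReal.ofReal_le_ofReal_iff h3).1 h2
  have h5 : mmseZ (boxInd r) v / v ≤ 1 - v * (1 - v) / 4 * boxMass r := by
    rw [div_le_iff₀ hv]; linarith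
  linarith

/-- At `v = 1` the estimator `e · 1_{[0,r]}(Z)` with `e = E[Z; Z ∈ [0,r]] > 0` has error `1 - 2e² +
e² p < 1`, where `p` is the mass of `[0,r]`. -/
lemma mmseZ_boxInd_one_lt {r : ℝ} (hr : 0 < r) : mmseZ (boxInd r) 1 < 1 := by
  have hm := measurable_boxInd r
  set e := ∫ z, boxInd r z * z ∂(gaussianReal 0 1) with he
  have hie : Integrable (fun z => boxInd r z * z) (gaussianReal 0 1) := by
    refine Integrable.bdd_mul (c := 1)
      ((memLp_id_gaussianReal' 2 (by simp)).integrable one_le_two) hm.aestronglyMeasurable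
      (ae_of_all _ fun z => ?_)
    by_cases hz : z ∈ Icc 0 r
    · simp [boxInd_of_mem hz]
    · simp [boxInd_of_notMem hz]
  have hnn : ∀ z, 0 ≤ boxInd r z * z := fun z => by
    by_cases hz : z ∈ Icc 0 r
    · rw [boxInd_of_mem hz, one_mul]; exact hz.1
    · rw [boxInd_of_notMem hz, zero_mul]
  have hepos : 0 < e := by
    rw [he, integral_pos_iff_support_of_nonneg hnn hie]
    refine (gaussianReal_pos_of_isOpen isOpen_Ioo (nonempty_Ioo.2 hr)).trans_le
      (measure_mono fun z hz => ?_)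
    rw [Function.mem_support, boxInd_of_mem (Ioo_subset_Icc_self hz), one_mul]
    exact hz.1.ne'
  have hle := mmseZ_le_residErr hm one_pos le_rfl (h := fun p => e * p.2) (by fun_prop)
  unfold residErr sqInt at hle
  simp only [sub_self, Real.sqrt_zero, Real.sqrt_one, zero_mul, zero_add, one_mul,
    ENNReal.ofReal_one] at hle
  have e0 : ∫⁻ ω : ℝ × ℝ, ENNReal.ofReal ((ω.2 - e * boxInd r ω.2) ^ 2) ∂gauss2 =
      ∫⁻ z, ENNReal.ofReal ((z - e * boxInd r z) ^ 2) ∂(gaussianReal 0 1) :=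
    measurePreserving_snd.lintegral_comp
      (f := fun z : ℝ => ENNReal.ofReal ((z - e * boxInd r z) ^ 2)) (by fun_prop)
  have e1 : ∀ z, (z - e * boxInd r z) ^ 2 =
      z ^ 2 - 2 * e * (boxInd r z * z) + e ^ 2 * boxInd r z := fun z => by
    by_cases hz : z ∈ Icc 0 r
    · rw [boxInd_of_mem hz]; ring
    · rw [boxInd_of_notMem hz]; ring
  have i1 : Integrable (fun z => z ^ 2 - 2 * e * (boxInd r z * z)) (gaussianReal 0 1) :=
    integrable_sq_gaussian.sub (hie.const_mul _)
  have i2 : Integrable (fun z => e ^ 2 * boxInd r z) (gaussianReal 0 1) :=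
    (integrable_boxInd r).const_mul _
  have hI : ∫ z, (z - e * boxInd r z) ^ 2 ∂(gaussianReal 0 1) =
      1 - 2 * e * e + e ^ 2 * boxMass r := by
    simp_rw [e1]
    rw [integral_add i1 i2, integral_sub integrable_sq_gaussian (hie.const_mul _),
      integral_const_mul, integral_const_mul, integral_sq_gaussian, integral_boxInd]
  have hi : Integrable (fun z => (z - e * boxInd r z) ^ 2) (gaussianReal 0 1) := by
    simp_rw [e1]; exact i1.add i2
  rw [e0, ← ofReal_integral_eq_lintegral_ofReal hi (ae_of_all _ fun _ => sq_nonneg _), hI] at hle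
  have hp1 : boxMass r ≤ 1 := measureReal_le_one
  have h0 : 0 ≤ 1 - 2 * e * e + e ^ 2 * boxMass r := by
    rw [← hI]; exact integral_nonneg fun _ => sq_nonneg _
  have := (ENNReal.ofReal_le_ofReal_iff h0).1 hle
  nlinarith [mul_le_mul_of_nonneg_left hp1 (sq_nonneg e), mul_pos hepos hepos]

/-- An estimate that is constant off a set `A` of probability at most `1/2` cannot reduce the
error by more than twice the second moment on `A`. -/
lemma one_le_add_setLIntegral {A : Set ℝ} (hA : MeasurableSet A)
    (hA2 : gaussianReal 0 1 A ≤ 1 / 2) {g : ℝ → ℝ} (x₀ : ℝ) (hg : ∀ w ∉ A, g w = x₀) :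
    1 ≤ ∫⁻ w, ENNReal.ofReal ((w - g w) ^ 2) ∂(gaussianReal 0 1) +
      2 * ∫⁻ w in A, ENNReal.ofReal (w ^ 2) ∂(gaussianReal 0 1) := by
  set γ := gaussianReal 0 1
  have h1 : ENNReal.ofReal (x₀ ^ 2) + 1 = ∫⁻ w, ENNReal.ofReal ((x₀ + (-1) * w) ^ 2) ∂γ := by
    rw [lintegral_affine_sq_gaussian, ENNReal.ofReal_add (sq_nonneg _) (sq_nonneg _)]
    simp
  -- Off `A` the integrand is the actual error. On `A` it is at most `2w² + 2x₀²`, and mass at most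
  -- `1/2` leaves `x₀²`, which cancels against the mean `x₀² + 1` of the left side.
  have h2 : ∫⁻ w, ENNReal.ofReal ((x₀ + (-1) * w) ^ 2) ∂γ ≤
      ∫⁻ w, ENNReal.ofReal ((w - g w) ^ 2) ∂γ +
      (2 * ∫⁻ w in A, ENNReal.ofReal (w ^ 2) ∂γ + ENNReal.ofReal (x₀ ^ 2)) := by
    rw [← lintegral_add_compl _ hA, add_comm]
    refine add_le_add ?_ ?_
    · calc ∫⁻ w in Aᶜ, ENNReal.ofReal ((x₀ + (-1) * w) ^ 2) ∂γ
          = ∫⁻ w in Aᶜ, ENNReal.ofReal ((w - g w) ^ 2) ∂γ := by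
            refine setLIntegral_congr_fun hA.compl fun w hw => ?_
            rw [hg w hw]; congr 1; ring
        _ ≤ _ := setLIntegral_le_lintegral _ _
    · calc ∫⁻ w in A, ENNReal.ofReal ((x₀ + (-1) * w) ^ 2) ∂γ
          ≤ ∫⁻ w in A, (2 * ENNReal.ofReal (w ^ 2) + ENNReal.ofReal (2 * x₀ ^ 2)) ∂γ := by
            refine lintegral_mono fun w => ?_
            rw [← ENNReal.ofReal_ofNat, ← ENNReal.ofReal_mul (by norm_num),
              ← ENNReal.ofReal_add (by positivity) (by positivity)]
            refine ENNReal.ofReal_le_ofReal ?_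
            nlinarith [sq_nonneg (x₀ + w)]
        _ = 2 * ∫⁻ w in A, ENNReal.ofReal (w ^ 2) ∂γ + ENNReal.ofReal (2 * x₀ ^ 2) * γ A := by
            rw [lintegral_add_right _ measurable_const, lintegral_const_mul _ (by fun_prop),
              setLIntegral_const]
        _ ≤ 2 * ∫⁻ w in A, ENNReal.ofReal (w ^ 2) ∂γ + ENNReal.ofReal (x₀ ^ 2) := by
            gcongr
            calc ENNReal.ofReal (2 * x₀ ^ 2) * γ A ≤ ENNReal.ofReal (2 * x₀ ^ 2) * (1 / 2) := by
                  gcongr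
              _ = ENNReal.ofReal (x₀ ^ 2) := by
                  rw [ENNReal.ofReal_mul (by norm_num), ENNReal.ofReal_ofNat, mul_comm, ← mul_assoc,
                    one_div, ENNReal.inv_mul_cancel (by simp) (by simp), one_mul]
  rw [← h1] at h2
  have h3 : ENNReal.ofReal (x₀ ^ 2) + 1 ≤ ENNReal.ofReal (x₀ ^ 2) +
      (∫⁻ w, ENNReal.ofReal ((w - g w) ^ 2) ∂γ + 2 * ∫⁻ w in A, ENNReal.ofReal (w ^ 2) ∂γ) := by
    refine h2.trans (le_of_eq ?_)
    ring
  exact (ENNReal.add_le_add_iff_left ENNReal.ofReal_ne_top).1 h3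

lemma boxInd_eq_boxInd_iff {r x y : ℝ} : boxInd r x = boxInd r y ↔ (x ∈ Icc 0 r ↔ y ∈ Icc 0 r) := by
  by_cases hx : x ∈ Icc 0 r <;> by_cases hy : y ∈ Icc 0 r <;>
    simp [boxInd_of_mem, boxInd_of_notMem, hx, hy]

lemma one_sub_le_of_residErr {f : ℝ → ℝ} (hf : Measurable f) {v K : ℝ} (hv : 0 < v) (hv1 : v ≤ 1)
    (hK : 0 ≤ K) (h : ∀ h : ℝ × ℝ → ℝ, Measurable h → 1 ≤ residErr f v h + ENNReal.ofReal K) :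
    1 - mmseZ f v / v ≤ K := by
  obtain ⟨h₀, hm, he⟩ := exists_residErr_eq hf hv hv1
  have h1 := mul_le_mul_right (h h₀ hm) (ENNReal.ofReal v)
  rw [mul_one, mul_add, ← he, ← ENNReal.ofReal_mul hv.le,
    ← ENNReal.ofReal_add (mmseZ_nonneg f v) (by positivity)] at h1
  have h2 := (ENNReal.ofReal_le_ofReal_iff
    (by have := mmseZ_nonneg f v; positivity)).1 h1
  rw [sub_le_iff_le_add, ← sub_le_iff_le_add', le_div_iff₀ hv]
  nlinarith

/-- Given `M`, the observation is constant unless `W` lies in an interval of length `r/√v ≤ 1/2`. By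
`one_le_add_setLIntegral` the gain is at most twice `E[W²; Z ∈ [0,r]]`, and `E[W² | Z = z] = v z² +
(1 - v)`. -/
lemma one_sub_le_mul_boxMass {r v : ℝ} (hr : r ≤ 1 / 4) (hv : 1 / 2 ≤ v)
    (hv1 : v ≤ 1) : 1 - mmseZ (boxInd r) v / v ≤ 2 * (r ^ 2 + (1 - v)) * boxMass r := by
  have hm := measurable_boxInd r
  have hv0 : 0 < v := by linarith
  have ha : √v ^ 2 = v := Real.sq_sqrt hv0.le
  have hb : √(1 - v) ^ 2 = 1 - v := Real.sq_sqrt (by linarith)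
  have hp0 : 0 ≤ boxMass r := measureReal_nonneg
  refine one_sub_le_of_residErr hm hv0 hv1
    (mul_nonneg (by have := sq_nonneg r; linarith) hp0) fun h hh => ?_
  have ha0 : 1 / 2 ≤ √v := Real.le_sqrt_of_sq_le (by nlinarith)
  unfold residErr sqInt
  set a := √v
  set b := √(1 - v)
  have hab : b ^ 2 + a ^ 2 = 1 := by rw [ha, hb]; ring
  let S : ℝ → Set ℝ := fun M => {w | b * M + a * w ∈ Icc 0 r}
  have hS : ∀ M, MeasurableSet (S M) := fun M =>
    measurableSet_Icc.preimage (by fun_prop : Measurable fun w : ℝ => b * M + a * w)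
  have hS2 : ∀ M, gaussianReal 0 1 (S M) ≤ 1 / 2 := fun M => by
    have hsub : S M ⊆ Icc (-(b * M) / a) ((r - b * M) / a) := fun w hw => by
      have h1 : 0 ≤ b * M + a * w := hw.1
      have h2 : b * M + a * w ≤ r := hw.2
      have ha' : 0 < a := by linarith
      exact ⟨by rw [div_le_iff₀ ha']; linarith, by rw [le_div_iff₀ ha']; linarith⟩
    refine (gaussianReal_le_volume _).trans ((measure_mono hsub).trans ?_)
    rw [Real.volume_Icc]
    have : (r - b * M) / a - -(b * M) / a ≤ 1 / 2 := by
      rw [← sub_div, div_le_iff₀ (by linarith)]; linarith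
    refine (ENNReal.ofReal_le_ofReal this).trans (le_of_eq ?_)
    rw [ENNReal.ofReal_div_of_pos (by norm_num)]; simp
  have key : ∀ M, 1 ≤ ∫⁻ w, (ENNReal.ofReal ((w - h (M, boxInd r (b * M + a * w))) ^ 2) +
      2 * ENNReal.ofReal (boxInd r (b * M + a * w) * w ^ 2)) ∂(gaussianReal 0 1) := fun M => by
    refine (one_le_add_setLIntegral (hS M) (hS2 M)
      (g := fun w => h (M, boxInd r (b * M + a * w))) (h (M, 0)) fun w hw => ?_).trans
      (le_of_eq ?_)
    · rw [boxInd_of_notMem hw]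
    · rw [lintegral_add_left (by fun_prop), lintegral_const_mul _ (by fun_prop),
        ← lintegral_indicator (hS M)]
      congr 2
      refine lintegral_congr fun w => ?_
      by_cases hw : w ∈ S M
      · rw [indicator_of_mem hw, boxInd_of_mem hw, one_mul]
      · rw [indicator_of_notMem hw, boxInd_of_notMem hw]; simp
  have h1 : 1 ≤ ∫⁻ ω : ℝ × ℝ, (ENNReal.ofReal ((ω.2 - h (ω.1, boxInd r (b * ω.1 + a * ω.2))) ^ 2) +
      2 * ENNReal.ofReal (boxInd r (b * ω.1 + a * ω.2) * ω.2 ^ 2)) ∂gauss2 := by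
    rw [lintegral_prod _ (by fun_prop)]
    calc (1 : ℝ≥0∞) = ∫⁻ _M, 1 ∂(gaussianReal 0 1) := by simp
      _ ≤ _ := lintegral_mono key
  rw [lintegral_add_left (by fun_prop), lintegral_const_mul _ (by fun_prop)] at h1
  refine h1.trans ?_
  gcongr
  have e := lintegral_combination_sq hab
    (A := fun z => a * boxInd r z) (B := fun z => - b * boxInd r z) (by fun_prop) (by fun_prop)
  have hidem : ∀ z, boxInd r z ^ 2 = boxInd r z := fun z => by
    by_cases hz : z ∈ Icc 0 r
    · rw [boxInd_of_mem hz, one_pow]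
    · rw [boxInd_of_notMem hz]; norm_num
  have e1 : ∫⁻ ω : ℝ × ℝ, ENNReal.ofReal (boxInd r (b * ω.1 + a * ω.2) * ω.2 ^ 2) ∂gauss2 =
      ∫⁻ z, ENNReal.ofReal ((a * boxInd r z * z) ^ 2 + (-b * boxInd r z) ^ 2)
        ∂(gaussianReal 0 1) := by
    rw [← e]
    refine lintegral_congr fun ω => ?_
    congr 1
    have h3 : a * boxInd r (b * ω.1 + a * ω.2) * (b * ω.1 + a * ω.2) +
        -b * boxInd r (b * ω.1 + a * ω.2) * (a * ω.1 - b * ω.2) =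
        boxInd r (b * ω.1 + a * ω.2) * ω.2 := by
      linear_combination (boxInd r (b * ω.1 + a * ω.2) * ω.2) * hab
    rw [h3, mul_pow, hidem]
  have hptw : ∀ z, (a * boxInd r z * z) ^ 2 + (-b * boxInd r z) ^ 2 ≤
      (r ^ 2 + (1 - v)) * boxInd r z := fun z => by
    by_cases hz : z ∈ Icc 0 r
    · rw [boxInd_of_mem hz]
      have hz2 : z ^ 2 ≤ r ^ 2 := by
        have := hz.1; gcongr; exact hz.2
      have e2 : (a * 1 * z) ^ 2 + (-b * 1) ^ 2 = v * z ^ 2 + (1 - v) := by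
        linear_combination z ^ 2 * ha + hb
      rw [e2]
      nlinarith [sq_nonneg z]
    · rw [boxInd_of_notMem hz]; simp
  have hnn : ∀ z, 0 ≤ (r ^ 2 + (1 - v)) * boxInd r z := fun z =>
    le_trans (by positivity) (hptw z)
  calc 2 * ∫⁻ ω : ℝ × ℝ, ENNReal.ofReal (boxInd r (b * ω.1 + a * ω.2) * ω.2 ^ 2) ∂gauss2
      ≤ 2 * ∫⁻ z, ENNReal.ofReal ((r ^ 2 + (1 - v)) * boxInd r z) ∂(gaussianReal 0 1) := by
        rw [e1]
        gcongr with z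
        exact hptw z
    _ = ENNReal.ofReal (2 * (r ^ 2 + (1 - v)) * boxMass r) := by
        rw [← ofReal_integral_eq_lintegral_ofReal ((integrable_boxInd r).const_mul _)
          (ae_of_all _ hnn), integral_const_mul, integral_boxInd, ← ENNReal.ofReal_ofNat,
          ← ENNReal.ofReal_mul (by norm_num), mul_assoc]

/-- The event that quantizing a noisy version of `M` differs from quantizing `M`. -/
def flipSet (r v : ℝ) : Set (ℝ × ℝ) :=
  {ω | boxInd r (√(1 - v) * ω.1 + √v * ω.2) ≠ boxInd r ω.1}

lemma measurableSet_flipSet (r v : ℝ) : MeasurableSet (flipSet r v) := by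
  have hm := measurable_boxInd r
  exact (measurableSet_eq_fun (by fun_prop) (by fun_prop)).compl

/-- Given `M`, the observation takes one value on the flip event and the other off it, so the less
likely of the two serves as exceptional set in `one_le_add_setLIntegral`. The second moment there is
split by `2w² ≤ η w⁴ + η⁻¹`. -/
lemma one_sub_le_flipSet {r v η : ℝ} (hv : 0 < v) (hv1 : v ≤ 1) (hη : 0 < η) :
    1 - mmseZ (boxInd r) v / v ≤
      η * ∫ w, w ^ 4 ∂(gaussianReal 0 1) + η⁻¹ * gauss2.real (flipSet r v) := by
  have hm := measurable_boxInd r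
  have hD := measurableSet_flipSet r v
  have hC : 0 ≤ ∫ w, w ^ 4 ∂(gaussianReal 0 1) := integral_nonneg fun w => by positivity
  have hi4 : Integrable (fun w : ℝ => w ^ 4) (gaussianReal 0 1) := by
    have h := (memLp_id_gaussianReal' (μ := 0) (v := 1) 4 (by simp)).integrable_norm_pow
      (by norm_num)
    refine h.congr (ae_of_all _ fun w => ?_)
    simp only [id, Real.norm_eq_abs]
    exact Even.pow_abs (by decide) w
  refine one_sub_le_of_residErr hm hv hv1 (by positivity) fun h hh => ?_
  set γ := gaussianReal 0 1
  let D : ℝ → Set ℝ := fun M => {w | boxInd r (√(1 - v) * M + √v * w) ≠ boxInd r M}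
  have hDM : ∀ M, MeasurableSet (D M) := fun M => measurable_prodMk_left hD
  have hbound : ∀ A : Set ℝ, 2 * ∫⁻ w in A, ENNReal.ofReal (w ^ 2) ∂γ ≤
      ENNReal.ofReal (η * ∫ w, w ^ 4 ∂γ) + ENNReal.ofReal η⁻¹ * γ A := fun A => by
    calc 2 * ∫⁻ w in A, ENNReal.ofReal (w ^ 2) ∂γ
        = ∫⁻ w in A, 2 * ENNReal.ofReal (w ^ 2) ∂γ := (lintegral_const_mul _ (by fun_prop)).symm
      _ ≤ ∫⁻ w in A, (ENNReal.ofReal (η * w ^ 4) + ENNReal.ofReal η⁻¹) ∂γ := by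
          refine lintegral_mono fun w => ?_
          rw [← ENNReal.ofReal_ofNat, ← ENNReal.ofReal_mul (by norm_num),
            ← ENNReal.ofReal_add (by positivity) (by positivity)]
          refine ENNReal.ofReal_le_ofReal ?_
          have : η * w ^ 4 + η⁻¹ - 2 * w ^ 2 = η * (w ^ 2 - η⁻¹) ^ 2 := by field_simp; ring
          have h2 : 0 ≤ η * (w ^ 2 - η⁻¹) ^ 2 := by positivity
          linarith
      _ = ∫⁻ w in A, ENNReal.ofReal (η * w ^ 4) ∂γ + ENNReal.ofReal η⁻¹ * γ A := by
          rw [lintegral_add_right _ measurable_const, setLIntegral_const]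
      _ ≤ _ := by
          gcongr
          refine (setLIntegral_le_lintegral _ _).trans (le_of_eq ?_)
          rw [← integral_const_mul, ofReal_integral_eq_lintegral_ofReal (hi4.const_mul η)
            (ae_of_all _ fun w => by positivity)]
  have key : ∀ M, 1 ≤ ∫⁻ w, ENNReal.ofReal
      ((w - h (M, boxInd r (√(1 - v) * M + √v * w))) ^ 2) ∂γ +
      (ENNReal.ofReal (η * ∫ w, w ^ 4 ∂γ) + ENNReal.ofReal η⁻¹ * γ (D M)) := fun M => by
    rcases le_total (γ (D M)) (1 / 2) with hle | hge
    · refine (one_le_add_setLIntegral (hDM M) hle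
        (g := fun w => h (M, boxInd r (√(1 - v) * M + √v * w))) (h (M, boxInd r M))
        fun w hw => ?_).trans (add_le_add_right (hbound _) _)
      rw [not_not.1 hw]
    · have hcompl : γ (D M)ᶜ ≤ 1 / 2 := by
        rw [prob_compl_eq_one_sub (hDM M), tsub_le_iff_right]
        calc (1 : ℝ≥0∞) = 1 / 2 + 1 / 2 := (ENNReal.add_halves 1).symm
          _ ≤ _ := by gcongr
      refine (one_le_add_setLIntegral (hDM M).compl hcompl
        (g := fun w => h (M, boxInd r (√(1 - v) * M + √v * w))) (h (M, 1 - boxInd r M))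
        fun w hw => ?_).trans (add_le_add_right ((hbound _).trans ?_) _)
      · have hw' : boxInd r (√(1 - v) * M + √v * w) ≠ boxInd r M := not_not.1 hw
        rw [Ne, boxInd_eq_boxInd_iff] at hw'
        have : boxInd r (√(1 - v) * M + √v * w) = 1 - boxInd r M := by
          by_cases h1 : √(1 - v) * M + √v * w ∈ Icc 0 r <;> by_cases h2 : M ∈ Icc 0 r <;>
            simp_all [boxInd_of_mem, boxInd_of_notMem]
        rw [this]
      · exact add_le_add_right (mul_le_mul_right (hcompl.trans hge) _) _
  have h1 : 1 ≤ ∫⁻ M, (∫⁻ w, ENNReal.ofReal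
      ((w - h (M, boxInd r (√(1 - v) * M + √v * w))) ^ 2) ∂γ +
      (ENNReal.ofReal (η * ∫ w, w ^ 4 ∂γ) + ENNReal.ofReal η⁻¹ * γ (D M))) ∂γ := by
    calc (1 : ℝ≥0∞) = ∫⁻ _M, 1 ∂γ := by simp
      _ ≤ _ := lintegral_mono key
  have hmD : Measurable fun M => γ (D M) := measurable_measure_prodMk_left hD
  have hmD' : Measurable fun M => ENNReal.ofReal (η * ∫ w, w ^ 4 ∂γ) + ENNReal.ofReal η⁻¹ * γ (D M) :=
    measurable_const.add (hmD.const_mul _)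
  rw [lintegral_add_right _ hmD',
    lintegral_add_left measurable_const,
    lintegral_const_mul _ hmD] at h1
  refine h1.trans (le_of_eq ?_)
  congr 1
  · unfold residErr sqInt
    rw [lintegral_prod _ (by fun_prop)]
  · rw [ENNReal.ofReal_add (by positivity) (by positivity),
      ENNReal.ofReal_mul (p := η⁻¹) (by positivity), ofReal_measureReal, Measure.prod_apply hD]
    simp only [lintegral_const, measure_univ, mul_one]
    rfl

/-- Almost surely `M` is not an endpoint of `[0,r]`, and then a small perturbation does not change
the indicator; dominated convergence applies. -/
lemma tendsto_flipSet (r : ℝ) :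
    Tendsto (fun v => gauss2.real (flipSet r v)) (𝓝 0) (𝓝 0) := by
  have hna := nullSingletonClass_gaussianReal (μ := 0) (v := 1) one_ne_zero
  have h : Tendsto (fun v => ∫⁻ ω, (flipSet r v).indicator 1 ω ∂gauss2) (𝓝 0)
      (𝓝 (∫⁻ _ω, 0 ∂gauss2)) := by
    refine tendsto_lintegral_filter_of_dominated_convergence (fun _ => 1) ?_ ?_ (by simp) ?_
    · exact Eventually.of_forall fun v => measurable_one.indicator (measurableSet_flipSet r v)
    · exact Eventually.of_forall fun v => ae_of_all _ fun ω => indicator_le_self' (by simp) ω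
    · have hne : ∀ c : ℝ, ∀ᵐ ω ∂gauss2, ω.1 ≠ c := fun c => by
        have h1 : ∀ᵐ z ∂(gaussianReal 0 1), z ≠ c := by
          rw [ae_iff]; simp
        exact measurePreserving_fst.quasiMeasurePreserving.ae h1
      filter_upwards [hne 0, hne r] with ω h0 hr
      have hc : Tendsto (fun v : ℝ => √(1 - v) * ω.1 + √v * ω.2) (𝓝 0) (𝓝 ω.1) := by
        have : Continuous fun v : ℝ => √(1 - v) * ω.1 + √v * ω.2 := by fun_prop
        simpa using this.tendsto 0
      have hev : ∀ᶠ v : ℝ in 𝓝 0, (√(1 - v) * ω.1 + √v * ω.2 ∈ Icc 0 r ↔ ω.1 ∈ Icc 0 r) := by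
        by_cases hmem : ω.1 ∈ Icc 0 r
        · have : Icc 0 r ∈ 𝓝 ω.1 :=
            Icc_mem_nhds (hmem.1.lt_of_ne h0.symm) (hmem.2.lt_of_ne hr)
          filter_upwards [hc this] with v hv
          exact ⟨fun _ => hmem, fun _ => hv⟩
        · have : (Icc 0 r)ᶜ ∈ 𝓝 ω.1 := isClosed_Icc.isOpen_compl.mem_nhds hmem
          filter_upwards [hc this] with v hv
          exact ⟨fun h => absurd h hv, fun h => absurd h hmem⟩
      refine tendsto_const_nhds.congr' ?_
      filter_upwards [hev] with v hv
      rw [indicator_of_notMem]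
      exact not_not.2 (boxInd_eq_boxInd_iff.2 hv)
  simp only [lintegral_indicator_one (measurableSet_flipSet r _), lintegral_zero] at h
  have h2 := (ENNReal.tendsto_toReal ENNReal.zero_ne_top).comp h
  rw [ENNReal.toReal_zero] at h2
  exact h2

lemma eventually_one_sub_lt (r : ℝ) {ε : ℝ} (hε : 0 < ε) :
    ∀ᶠ v in 𝓝[>] (0 : ℝ), 1 - mmseZ (boxInd r) v / v < ε := by
  set C := ∫ w, w ^ 4 ∂(gaussianReal 0 1) with hCdef
  have hC : 0 ≤ C := integral_nonneg fun w => by positivity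
  set η := ε / (2 * (C + 1)) with hηdef
  have hη : 0 < η := by positivity
  have hηC : η * C < ε / 2 := by
    rw [hηdef, div_mul_eq_mul_div, div_lt_div_iff₀ (by positivity) (by norm_num)]
    nlinarith
  have hflip := (tendsto_flipSet r).eventually_lt_const (show 0 < η * (ε / 2) by positivity)
  filter_upwards [hflip.filter_mono nhdsWithin_le_nhds, Ioc_mem_nhdsGT (zero_lt_one' ℝ)]
    with v hv hv1
  have h1 := one_sub_le_flipSet (r := r) hv1.1 hv1.2 hη
  have h2 : η⁻¹ * gauss2.real (flipSet r v) < ε / 2 := by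
    rw [inv_mul_lt_iff₀ hη]; exact hv
  linarith

/-- At some `w ≤ v` the relative gain is below `1`, so the MMSE is positive there, and it is
monotone. -/
lemma mmseZ_boxInd_pos (r : ℝ) {v : ℝ} (hv : 0 < v) (hv1 : v ≤ 1) : 0 < mmseZ (boxInd r) v := by
  obtain ⟨w, hw, hw1⟩ := ((eventually_one_sub_lt r one_pos).and (Ioc_mem_nhdsGT hv)).exists
  have h1 : 0 < mmseZ (boxInd r) w / w := by linarith
  exact ((div_pos_iff_of_pos_right hw1.1).1 h1).trans_le
    (mmseZ_mono (measurable_boxInd r) hw1.1 hw1.2 hv1)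

/-! ### Spectra for which the comparison fails -/

/-- A spectrum with one small and one large eigenvalue. -/
lemma exists_twoPoint_spectrum {δ ε Λ : ℝ} (hε : 0 < ε) (hεδ : ε < δ) (hΛ : δ < Λ) :
    ∃ P : Measure ℝ, IsLimitingSpectrum δ P ∧ ∀ x, 0 ≤ x →
      (δ - ε) / (1 + x * Λ) ≤ harm P x ∧ harm P x ≤ ε + δ / (1 + x * Λ) := by
  set ρ := (δ - ε) / (Λ - ε) with hρ
  have hd : 0 < Λ - ε := by linarith
  have hρ0 : 0 < ρ := div_pos (by linarith) hd
  have hρ1 : ρ < 1 := by rw [hρ, div_lt_one hd]; linarith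
  have hρΛ : (1 - ρ) * ε + ρ * Λ = δ := by
    have : ρ * (Λ - ε) = δ - ε := by rw [hρ]; field_simp
    linarith
  set P : Measure ℝ := ENNReal.ofReal (1 - ρ) • Measure.dirac ε + ENNReal.ofReal ρ • Measure.dirac Λ
    with hP
  have hint : ∀ F : ℝ → ℝ, Measurable F → ∫ x, F x ∂P = (1 - ρ) * F ε + ρ * F Λ := fun F hF => by
    have hi : ∀ (c y : ℝ), Integrable F (ENNReal.ofReal c • Measure.dirac y) := fun c y =>
      (integrable_dirac' hF.stronglyMeasurable (by simp)).smul_measure ENNReal.ofReal_ne_top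
    rw [hP, integral_add_measure (hi _ _) (hi _ _), integral_smul_measure, integral_smul_measure,
      integral_dirac, integral_dirac, ENNReal.toReal_ofReal (by linarith),
      ENNReal.toReal_ofReal hρ0.le, smul_eq_mul, smul_eq_mul]
  refine ⟨P, ⟨⟨?_⟩, ⟨ε, Λ, hε, ?_⟩, ?_⟩, fun x hx => ?_⟩
  · rw [hP, Measure.add_apply, Measure.smul_apply, Measure.smul_apply, measure_univ, measure_univ,
      smul_eq_mul, smul_eq_mul, mul_one, mul_one, ← ENNReal.ofReal_add (by linarith) hρ0.le]
    simp
  · have h1 : ε ∉ (Icc ε Λ)ᶜ := fun h => h ⟨le_rfl, by linarith⟩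
    have h2 : Λ ∉ (Icc ε Λ)ᶜ := fun h => h ⟨by linarith, le_rfl⟩
    rw [hP, Measure.add_apply, Measure.smul_apply, Measure.smul_apply,
      Measure.dirac_apply' _ measurableSet_Icc.compl, Measure.dirac_apply' _ measurableSet_Icc.compl,
      indicator_of_notMem h1, indicator_of_notMem h2]
    simp
  · exact (hint (fun x => x) measurable_id).trans hρΛ
  · have hΛ0 : 0 < Λ := by linarith
    have e : harm P x = (1 - ρ) * (ε / (1 + x * ε)) + ρ * Λ / (1 + x * Λ) := by
      unfold harm
      rw [hint (fun l => l / (1 + x * l)) (by fun_prop), mul_div_assoc]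
    have h1 : 0 ≤ ε / (1 + x * ε) := by positivity
    have h2 : ε / (1 + x * ε) ≤ ε := div_le_self hε.le (by nlinarith [mul_nonneg hx hε.le])
    -- The large eigenvalue carries nearly the whole mean `δ`, so `H(x)` is `δ/(1+xΛ)` up to `ε`.
    have h3 : δ - ε ≤ ρ * Λ := by nlinarith
    have h4 : ρ * Λ ≤ δ := by nlinarith
    have h5 : 0 < 1 + x * Λ := by positivity
    have h6 := div_le_div_of_nonneg_right h3 h5.le
    have h7 := div_le_div_of_nonneg_right h4 h5.le
    rw [e]
    constructor
    · have := mul_nonneg (by linarith : 0 ≤ 1 - ρ) h1; linarith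
    · nlinarith

lemma harm_dirac (δ x : ℝ) : harm (Measure.dirac δ) x = δ / (1 + x * δ) := by
  simp [harm, integral_dirac]

section Indefinite

variable {f : ℝ → ℝ} {δ : ℝ} {P : Measure ℝ}

/-- Whether the step lowers `v` is decided by comparing `H(ψ(v))` with `δ mmse_z(v)`, the two sides
of the fixed-point equation; `self_le_step` is the opposite case. -/
lemma step_lt_self (hf : Measurable f) (hδ : 1 < δ) (hP : IsLimitingSpectrum δ P) {v : ℝ}
    (hv : 0 < v) (hv1 : v ≤ 1) (hpos : 0 < mmseZ f v) (h : harm P (psi f v) < δ * mmseZ f v) :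
    Phi δ P (phi f v) < v := by
  have hψ := psi_nonneg hf hv hv1 hpos
  have hH := hP.harm_pos hψ
  rw [step_eq hf hδ hP hv hv1 hpos]
  have h1 : (mmseZ f v)⁻¹ < δ / harm P (psi f v) := by
    rw [lt_div_iff₀ hH, inv_mul_lt_iff₀ hpos]; linarith
  rw [← psi_add_inv] at h1
  rw [inv_lt_comm₀ (by linarith [inv_pos.2 hv]) hv]
  linarith

lemma self_le_step (hf : Measurable f) (hδ : 1 < δ) (hP : IsLimitingSpectrum δ P) {v : ℝ}
    (hv : 0 < v) (hv1 : v ≤ 1) (hpos : 0 < mmseZ f v) (h : δ * mmseZ f v ≤ harm P (psi f v)) :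
    v ≤ Phi δ P (phi f v) := by
  have hψ := psi_nonneg hf hv hv1 hpos
  have hH := hP.harm_pos hψ
  rw [step_eq hf hδ hP hv hv1 hpos]
  have h1 : δ / harm P (psi f v) ≤ (mmseZ f v)⁻¹ := by
    rw [div_le_iff₀ hH, le_inv_mul_iff₀ hpos]; linarith
  rw [← psi_add_inv] at h1
  rw [le_inv_comm₀ hv (by linarith [hP.one_le_prec hδ hψ])]
  linarith

lemma mse_phi_le_mseStar (hf : Measurable f) (hδ : 1 < δ) (hP : IsLimitingSpectrum δ P) {v : ℝ}
    (hv : v ∈ Icc (0 : ℝ) 1) (hle : v ≤ Phi δ P (phi f v)) :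
    mse P (phi f v) ≤ mseStar f δ P :=
  hP.mse_mono (phi_monotoneOn hf hv (Vstar_mem hf hδ hP) (le_Vstar hf hδ hP hv hle))

lemma mseStar_le_mse_phi (hf : Measurable f) (hδ : 1 < δ) (hP : IsLimitingSpectrum δ P) {v : ℝ}
    (hv : v ∈ Icc (0 : ℝ) 1) (h : ∀ w ∈ Icc v 1, Phi δ P (phi f w) < w) :
    mseStar f δ P ≤ mse P (phi f v) := by
  have hm := Vstar_mem hf hδ hP
  refine hP.mse_mono (phi_monotoneOn hf hm hv ?_)
  by_contra hlt
  rw [not_le] at hlt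
  have hfix := (step_Vstar hf hδ hP (hv.1.trans_lt hlt)).2
  exact (h _ ⟨hlt.le, hm.2⟩).ne hfix

lemma mseStar_le_mse_phi_one (hf : Measurable f) (hδ : 1 < δ) (hP : IsLimitingSpectrum δ P) :
    mseStar f δ P ≤ mse P (phi f 1) := by
  have hm := Vstar_mem hf hδ hP
  exact hP.mse_mono (phi_monotoneOn hf hm ⟨zero_le_one, le_rfl⟩ hm.2)

lemma psi_mul_mmseZ {v : ℝ} (hpos : 0 < mmseZ f v) :
    psi f v * mmseZ f v = 1 - mmseZ f v / v := by
  unfold psi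
  rw [sub_mul, inv_mul_cancel₀ hpos.ne', inv_mul_eq_div]

/-- For a nonlinearity which at small `v` reveals almost nothing, some spikier spectrum has a
larger error than the constant one. -/
lemma exists_mseStar_dirac_lt (hf : Measurable f) (hδ : 1 < δ)
    (hpos : ∀ v, 0 < v → v ≤ 1 → 0 < mmseZ f v) (h1 : mmseZ f 1 < 1)
    (hsmall : ∀ ε : ℝ, 0 < ε → ∃ v, 0 < v ∧ v ≤ 1 ∧ 1 - mmseZ f v / v < ε) :
    ∃ P : Measure ℝ, IsLimitingSpectrum δ P ∧
      mseStar f δ (Measure.dirac δ) < mseStar f δ P := by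
  have hδ0 : 0 < δ := by linarith
  have hD := isLimitingSpectrum_dirac hδ0
  set x₁ := psi f 1 with hx₁
  have hx₁0 : 0 < x₁ := by
    rw [hx₁, psi, inv_one, sub_pos]
    exact (one_lt_inv₀ (hpos 1 one_pos le_rfl)).2 h1
  set T₂ := δ * x₁ / (1 + δ * x₁) with hT₂
  have hT₂0 : 0 < T₂ := by positivity
  -- The error of the constant spectrum is at most its value at the start `v = 1`.
  have hMD : mseStar f δ (Measure.dirac δ) ≤ 1 - T₂ := by
    refine (mseStar_le_mse_phi_one hf hδ hD).trans (le_of_eq ?_)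
    rw [mse_phi_eq hf hD one_pos le_rfl (hpos 1 one_pos le_rfl), harm_dirac, ← hx₁, hT₂]
    ring
  obtain ⟨v, hv, hv1, hq⟩ := hsmall (T₂ / (2 * δ)) (by positivity)
  have hm := hpos v hv hv1
  set x := psi f v with hx
  have hxx : x₁ ≤ x := psi_antitone hf hv hv1 le_rfl hm
  have hx0 : 0 < x := hx₁0.trans_le hxx
  have hqx : δ * (x * mmseZ f v) < T₂ / 2 := by
    rw [hx, psi_mul_mmseZ hm]
    rw [lt_div_iff₀ (by positivity)] at hq ⊢
    linarith
  -- The aim is `δ x mmse_z(v) ≤ x H(x) < T₂`: the left bound blocks the iteration at `v`, the right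
  -- one makes the error exceed `1 - T₂`. The target `T` lies between `T₂/2` and `T₂`; `Λ` solves
  -- `xδ/(1+xΛ) = T`, and `ε` is small enough to stay within the margins.
  set T := 3 / 4 * T₂ with hT
  have hT0 : 0 < T := by positivity
  set Λ := δ / T - 1 / x with hΛ
  have hxΛ : 1 + x * Λ = x * δ / T := by rw [hΛ]; field_simp; ring
  have hΛδ : δ < Λ := by
    have h2 : δ / T₂ = 1 / x₁ + δ := by rw [hT₂]; field_simp
    have h3 : δ / T₂ < δ / T := div_lt_div_of_pos_left hδ0 hT0 (by linarith)
    have h4 : 1 / x ≤ 1 / x₁ := one_div_le_one_div_of_le hx₁0 hxx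
    linarith
  set ε := min (δ / 4) (T₂ / (8 * x)) with hε
  have hε0 : 0 < ε := by positivity
  have hε1 : ε ≤ δ / 4 := min_le_left _ _
  have hε2 : ε * x ≤ T₂ / 8 := by
    have : ε ≤ T₂ / (8 * x) := min_le_right _ _
    rw [le_div_iff₀ (by positivity)] at this ⊢
    linarith
  obtain ⟨P, hP, hH⟩ := exists_twoPoint_spectrum hε0 (by linarith : ε < δ) hΛδ
  refine ⟨P, hP, ?_⟩
  obtain ⟨hl, hu⟩ := hH x hx0.le
  rw [hxΛ] at hl hu
  have hl' : δ * mmseZ f v ≤ harm P x := by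
    refine le_trans ?_ hl
    rw [le_div_iff₀ (by positivity)]
    have e : δ * mmseZ f v * (x * δ / T) = δ * (x * mmseZ f v) * (δ / T) := by ring
    rw [e]
    have h5 : δ * (x * mmseZ f v) * (δ / T) ≤ T₂ / 2 * (δ / T) := by gcongr
    have h6 : T₂ / 2 * (δ / T) = 2 / 3 * δ := by rw [hT]; field_simp; norm_num
    linarith
  have hu' : x * harm P x < T₂ := by
    have h5 : x * harm P x ≤ x * (ε + δ / (x * δ / T)) := by gcongr
    have h6 : x * (ε + δ / (x * δ / T)) = ε * x + T := by field_simp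
    linarith
  have h7 := mse_phi_le_mseStar hf hδ hP ⟨hv.le, hv1⟩ (self_le_step hf hδ hP hv hv1 hm hl')
  rw [mse_phi_eq hf hP hv hv1 hm, ← hx] at h7
  linarith

/-- If `1 - mmse_z(v)/v` is bounded below linearly in `1 - v` and small at some point close to
`1`, some spikier spectrum has a smaller error than the constant one. -/
lemma exists_mseStar_lt_dirac (hf : Measurable f) (hδ : 1 < δ)
    (hpos : ∀ v, 0 < v → v ≤ 1 → 0 < mmseZ f v) (h1 : mmseZ f 1 < 1) {p u : ℝ} (hp : 0 < p)
    (hδp : δ * p ≤ 1) (hu : 1 / 2 ≤ u) (hu1 : u ≤ 1)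
    (hlow : ∀ v, 0 < v → v ≤ 1 → v * (1 - v) * p / 4 ≤ 1 - mmseZ f v / v)
    (hup : δ * (1 - mmseZ f u / u) ≤ 1 - u) (hup2 : 1 - mmseZ f u / u ≤ p / 250) :
    ∃ P : Measure ℝ, IsLimitingSpectrum δ P ∧
      mseStar f δ P < mseStar f δ (Measure.dirac δ) := by
  have hδ0 : 0 < δ := by linarith
  have hD := isLimitingSpectrum_dirac hδ0
  have hu0 : 0 < u := by linarith
  have hmu := hpos u hu0 hu1
  -- The small gain at `u` blocks the constant spectrum there, so its error is at least `1 - δ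
  -- ψ(u)`.
  have hMD : 1 - δ * p / 100 ≤ mseStar f δ (Measure.dirac δ) := by
    set q := 1 - mmseZ f u / u with hq
    have hψ := psi_nonneg hf hu0 hu1 hmu
    have hψm : psi f u * mmseZ f u = q := psi_mul_mmseZ hmu
    have hmu2 : mmseZ f u = u * (1 - q) := by rw [hq]; field_simp; ring
    have hq0 : 0 ≤ q := by rw [← hψm]; positivity
    have hstep : u ≤ Phi δ (Measure.dirac δ) (phi f u) := by
      refine self_le_step hf hδ hD hu0 hu1 hmu ?_
      rw [harm_dirac, le_div_iff₀ (by positivity)]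
      have e : δ * mmseZ f u * (1 + psi f u * δ) =
        δ * (mmseZ f u + (psi f u * mmseZ f u) * δ) := by ring
      rw [e, hψm, hmu2]
      nlinarith
    refine le_trans ?_ (mse_phi_le_mseStar hf hδ hD ⟨hu0.le, hu1⟩ hstep)
    rw [mse_phi_eq hf hD hu0 hu1 hmu, harm_dirac]
    have h2 : psi f u * (δ / (1 + psi f u * δ)) ≤ psi f u * δ := by
      gcongr
      exact div_le_self hδ0.le (by nlinarith [mul_nonneg hψ hδ0.le])
    have h3 : psi f u ≤ p / 100 := by
      have hm : 2 / 5 ≤ mmseZ f u := by rw [hmu2]; nlinarith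
      have : psi f u * (2 / 5) ≤ q := by rw [← hψm]; gcongr
      linarith
    have h4 : psi f u * δ ≤ p / 100 * δ := by gcongr
    linarith
  have hpsi : ∀ v, 0 < v → v ≤ 1 → (1 - v) * p / 4 ≤ psi f v := fun v hv hv1 => by
    have hm := hpos v hv hv1
    have h2 := hlow v hv hv1
    rw [← psi_mul_mmseZ hm] at h2
    have h3 := mul_le_mul_of_nonneg_left (mmseZ_le_self hf hv hv1) (psi_nonneg hf hv hv1 hm)
    have h4 : v * ((1 - v) * p / 4) ≤ v * psi f v := by linarith
    exact le_of_mul_le_mul_left h4 hv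
  have hx₁0 : 0 < psi f 1 := by
    rw [psi, inv_one, sub_pos]
    exact (one_lt_inv₀ (hpos 1 one_pos le_rfl)).2 h1
  set x₁ := psi f 1
  have hm0 : 0 < mmseZ f (1 / 2) := hpos _ (by norm_num) (by norm_num)
  set m₀ := mmseZ f (1 / 2) with hm₀
  -- The term `16/p` in `Λ` is used in two halves: one gives `(8/p)ψ(v) ≥ 2(1-v) ≥ 1/v - 1` on
  -- `[1/2,1]`, the other the uniform slack `κ`. Then `δ/(1+ψΛ)` falls short of `δ mmse` by at least
  -- `δη`, which absorbs `ε ≤ δη/2`.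
  set κ := 8 / p * x₁ with hκ
  have hκ0 : 0 < κ := by positivity
  set η := m₀ * (m₀ * κ / (1 + m₀ * κ)) with hη
  have hη0 : 0 < η := by positivity
  set ε := min (δ / 2) (δ * η / 2) with hε
  have hε0 : 0 < ε := by positivity
  have hε1 : ε ≤ δ / 2 := min_le_left _ _
  have hε2 : ε ≤ δ * η / 2 := min_le_right _ _
  set Λ := δ + 16 / p with hΛ
  have hp16 : 0 < 16 / p := by positivity
  obtain ⟨P, hP, hH⟩ := exists_twoPoint_spectrum hε0 (by linarith : ε < δ)
    (by linarith : δ < Λ)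
  refine ⟨P, hP, ?_⟩
  have hstep : ∀ v ∈ Icc (1 / 2 : ℝ) 1, Phi δ P (phi f v) < v := fun v hv => by
    have hv0 : 0 < v := by linarith [hv.1]
    have hm := hpos v hv0 hv.2
    refine step_lt_self hf hδ hP hv0 hv.2 hm ?_
    have hψ := psi_nonneg hf hv0 hv.2 hm
    refine (hH _ hψ).2.trans_lt ?_
    have hψ1 : x₁ ≤ psi f v := psi_antitone hf hv0 hv.2 le_rfl hm
    have hψ2 := hpsi v hv0 hv.2
    have hmm : m₀ ≤ mmseZ f v := mmseZ_mono hf (by norm_num) hv.1 hv.2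
    have hsum := psi_add_inv f v
    set x := psi f v
    set m := mmseZ f v
    have h3 : m⁻¹ + κ ≤ 1 + x * Λ := by
      have h4 : κ ≤ 8 / p * x := by rw [hκ]; gcongr
      have h5 : 2 * (1 - v) ≤ 8 / p * x := by
        calc 2 * (1 - v) = 8 / p * ((1 - v) * p / 4) := by field_simp; ring
          _ ≤ _ := by gcongr
      have h6 : v⁻¹ ≤ 1 + 2 * (1 - v) := by
        rw [inv_le_iff_one_le_mul₀ hv0]; nlinarith [hv.1, hv.2]
      have h7 : x * Λ = x * δ + 2 * (8 / p * x) := by rw [hΛ]; ring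
      have h8 : x ≤ x * δ := le_mul_of_one_le_right hψ hδ.le
      linarith
    have hmi : 0 < m⁻¹ + κ := by positivity
    have h9 : δ / (1 + x * Λ) ≤ δ / (m⁻¹ + κ) := div_le_div_of_nonneg_left hδ0.le hmi h3
    have h10 : δ / (m⁻¹ + κ) = δ * m - δ * (m * (m * κ / (1 + m * κ))) := by
      field_simp; ring
    have h11 : η ≤ m * (m * κ / (1 + m * κ)) := by
      have h12 : m₀ * κ / (1 + m₀ * κ) ≤ m * κ / (1 + m * κ) := by
        rw [div_le_div_iff₀ (by positivity) (by positivity)]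
        nlinarith [mul_le_mul_of_nonneg_right hmm hκ0.le]
      rw [hη]
      gcongr
    have h13 : δ * η ≤ δ * (m * (m * κ / (1 + m * κ))) := by gcongr
    have h14 : 0 < δ * η := by positivity
    linarith
  -- No fixed point remains in `[1/2,1]`, and at `1/2` the bound `ψ ≥ p/8` gives `ψ H(ψ) ≥ δp/50`,
  -- twice the loss `δp/100` allowed for the constant spectrum.
  have hle := mseStar_le_mse_phi hf hδ hP (v := 1 / 2) ⟨by norm_num, by norm_num⟩ hstep
  refine (hle.trans_lt ?_).trans_le hMD
  rw [mse_phi_eq hf hP (by norm_num) (by norm_num) hm0]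
  have hψ := psi_nonneg hf (by norm_num) (by norm_num) hm0
  have hψ2 := hpsi (1 / 2) (by norm_num) (by norm_num)
  set x := psi f (1 / 2)
  have hx8 : p / 8 ≤ x := by linarith
  have hl := (hH x hψ).1
  have hx0 : 0 < x := by linarith
  have h15 : x * ((δ - ε) / (1 + x * Λ)) ≤ x * harm P x := by gcongr
  have h16 : δ * p / 50 ≤ x * ((δ - ε) / (1 + x * Λ)) := by
    have hΛ0 : 0 < Λ := by positivity
    rw [← mul_div_assoc, le_div_iff₀ (by positivity)]
    have hpΛ : p * Λ ≤ 17 := by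
      have : p * Λ = δ * p + 16 := by rw [hΛ]; field_simp
      linarith
    have h17 : x * (δ / 2) ≤ x * (δ - ε) := by gcongr; linarith
    have h18 : p * (1 + x * Λ) ≤ 25 * x := by nlinarith
    have h19 : δ * (p * (1 + x * Λ)) ≤ δ * (25 * x) := by gcongr
    linarith
  have h20 : 0 < δ * p := by positivity
  linarith

end Indefinite

theorem exists_indefinite_comparison {δ : ℝ} (hδ : 1 < δ) :
    ∃ f : ℝ → ℝ, IsAdmissible f ∧
      (∃ P : Measure ℝ, IsLimitingSpectrum δ P ∧
        mseStar f δ P < mseStar f δ (Measure.dirac δ)) ∧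
      (∃ P : Measure ℝ, IsLimitingSpectrum δ P ∧
        mseStar f δ (Measure.dirac δ) < mseStar f δ P) := by
  have hδ0 : 0 < δ := by linarith
  -- At `u = 1 - r` the gain is at most `4rp`, with `p ≤ r` the mass of `[0,r]`. This scale of `r`
  -- yields both `4δrp ≤ r = 1 - u` and `4rp ≤ p/250`.
  set r := 1 / (1000 * δ) with hr
  have hr0 : 0 < r := by positivity
  have hδr : δ * r = 1 / 1000 := by rw [hr]; field_simp
  have hr1 : r ≤ 1 / 1000 := by nlinarith
  have hf := measurable_boxInd r
  have hp := boxMass_pos hr0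
  have hpr := boxMass_le hr0.le
  have hpos : ∀ v, 0 < v → v ≤ 1 → 0 < mmseZ (boxInd r) v := fun v => mmseZ_boxInd_pos r
  have h1 := mmseZ_boxInd_one_lt hr0
  have hup := one_sub_le_mul_boxMass (r := r) (v := 1 - r) (by linarith) (by linarith)
    (by linarith)
  set p := boxMass r
  have hδp : δ * p ≤ 1 / 1000 := by rw [← hδr]; gcongr
  have hq : 1 - mmseZ (boxInd r) (1 - r) / (1 - r) ≤ 4 * (r * p) := by
    refine hup.trans ?_
    have : r ^ 2 ≤ r := by nlinarith
    nlinarith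
  refine ⟨boxInd r, isAdmissible_boxInd hr0.le, ?_, ?_⟩
  · refine exists_mseStar_lt_dirac hf hδ hpos h1 hp (u := 1 - r) (by linarith) (by linarith)
      (by linarith) (fun v hv hv1 => mul_boxMass_le_one_sub (by linarith) hv hv1) ?_ ?_
    · have h2 := mul_le_mul_of_nonneg_left hq hδ0.le
      have h3 := mul_le_mul_of_nonneg_left hδp hr0.le
      linarith
    · have := mul_le_mul_of_nonneg_right hr1 hp.le
      linarith
  · refine exists_mseStar_dirac_lt hf hδ hpos h1 fun ε hε => ?_
    obtain ⟨v, hv, hv1⟩ := ((eventually_one_sub_lt r hε).and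
      (Ioc_mem_nhdsGT (zero_lt_one' ℝ))).exists
    exact ⟨v, hv1.1, hv1.2, hv⟩

end

end GLMEP

theorem mainTheorem4 :
    (∀ (f : ℝ → ℝ) (δ : ℝ) (P₁ P₂ : Measure ℝ), GLMEP.IsAdmissible f → 1 < δ →
      GLMEP.IsLimitingSpectrum δ P₁ → GLMEP.IsLimitingSpectrum δ P₂ → GLMEP.Spikier P₁ P₂ →
      Tendsto (GLMEP.seVr f δ P₁) atTop (𝓝 (GLMEP.Vstar f δ P₁)) ∧
      Tendsto (GLMEP.seVr f δ P₂) atTop (𝓝 (GLMEP.Vstar f δ P₂)) ∧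
      (MonotoneOn (GLMEP.GFun f δ) (Icc 0 1) →
        GLMEP.mseStar f δ P₁ ≤ GLMEP.mseStar f δ P₂) ∧
      (AntitoneOn (GLMEP.GFun f δ) (Icc 0 1) →
        GLMEP.mseStar f δ P₂ ≤ GLMEP.mseStar f δ P₁)) ∧
    (∀ δ : ℝ, 1 < δ → ∃ f : ℝ → ℝ, GLMEP.IsAdmissible f ∧
      ¬ MonotoneOn (GLMEP.GFun f δ) (Icc 0 1) ∧ ¬ AntitoneOn (GLMEP.GFun f δ) (Icc 0 1) ∧
      (∃ P₁ P₂ : Measure ℝ, GLMEP.IsLimitingSpectrum δ P₁ ∧ GLMEP.IsLimitingSpectrum δ P₂ ∧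
        GLMEP.Spikier P₁ P₂ ∧ GLMEP.mseStar f δ P₁ < GLMEP.mseStar f δ P₂) ∧
      (∃ P₁ P₂ : Measure ℝ, GLMEP.IsLimitingSpectrum δ P₁ ∧ GLMEP.IsLimitingSpectrum δ P₂ ∧
        GLMEP.Spikier P₁ P₂ ∧ GLMEP.mseStar f δ P₂ < GLMEP.mseStar f δ P₁)) := by
  refine ⟨fun f δ P₁ P₂ hf hδ h₁ h₂ h => ?_, fun δ hδ => ?_⟩
  · have hm := hf.measurable
    exact ⟨GLMEP.tendsto_seVr hm hδ h₁, GLMEP.tendsto_seVr hm hδ h₂,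
      GLMEP.mseStar_le_of_monotoneOn hm hδ h₁ h₂ h, GLMEP.mseStar_le_of_antitoneOn hm hδ h₁ h₂ h⟩
  · obtain ⟨f, hf, ⟨P, hP, hlt⟩, ⟨P', hP', hlt'⟩⟩ := GLMEP.exists_indefinite_comparison hδ
    have hδ0 : 0 < δ := by linarith
    have hD := GLMEP.isLimitingSpectrum_dirac hδ0
    have hm := hf.measurable
    -- Either kind of monotonicity of `G` would contradict one of the two strict inequalities
    -- through the comparison already proved.
    refine ⟨f, hf, fun hG => ?_, fun hG => ?_, ⟨P, _, hP, hD, hP.spikier_dirac hδ0, hlt⟩,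
      ⟨P', _, hP', hD, hP'.spikier_dirac hδ0, hlt'⟩⟩
    · exact absurd (GLMEP.mseStar_le_of_monotoneOn hm hδ hP' hD (hP'.spikier_dirac hδ0) hG)
        (not_le.2 hlt')
    · exact absurd (GLMEP.mseStar_le_of_antitoneOn hm hδ hP hD (hP.spikier_dirac hδ0) hG)
        (not_le.2 hlt)
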